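/- **Theorem (Power of the Gaussian multiplier bootstrap for the CUSUM test under $H_1$).** *Model.* Let $n\ge 4$, $p\ge 3$, and let $$X_i=\mu+\delta_n\mathbf 1(i>m)+\xi_i,\qquad i=1,\dots,n,$$ where $\mu,\delta_n\in\mathbb R^p$ and $\xi_1,\dots,\xi_n$ are i.i.d. mean-zero random vectors in $\mathbb R^p$. Let $t_m=m/n$, and let $\underline s\in[1,n/2]$ be the boundary removal parameter. Below, $s$ ranges over integers and $|\cdot|_\infty$ is the maximum norm on $\mathbb R^p$. *Test.* With $\bar X_s^-=s^{-1}\sum_{i\le s}X_i$ and $\bar X_s^+=(n-s)^{-1}\sum_{i>s}X_i$, let $$Z_n(s)=\sqrt{\tfrac{s(n-s)}{n}}\,(\bar X_s^--\bar X_s^+),\qquad T_n=\max_{\underline s\le s\le n-\underline s}|Z_n(s)|_\infty .$$ Let $e_1,\dots,e_n$ be i.i.d. $N(0,1)$, independent of $X_1^n=(X_1,\dots,X_n)$, and let $$Z_n^*(s)=\sqrt{\tfrac{n-s}{ns}}\sum_{i\le s}e_i(X_i-\bar X_s^-)-\sqrt{\tfrac{s}{n(n-s)}}\sum_{i>s}e_i(X_i-\bar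 X_s^+),\qquad T_n^*=\max_{\underline s\le s\le n-\underline s}|Z_n^*(s)|_\infty .$$ For $\alpha\in(0,1)$ the bootstrap test rejects if $T_n>q_{T_n^*\mid X_1^n}(1-\alpha)$, where $q_{T_n^*\mid X_1^n}(1-\alpha)=\inf\{t\in\mathbb R:\mathbb P(T_n^*\le t\mid X_1^n)\ge 1-\alpha\}$. *Conditions.* Let $\underline b,\bar b,q>0$, and let $\|Y\|_{\psi_1}=\inf\{C>0:\mathbb E[e^{|Y|/C}-1]\le 1\}$. Consider, for all $i=1,\dots,n$ and $j=1,\dots,p$: - (A) $\mathrm{Var}(\xi_{ij})\ge\underline b$; - (B) $\mathbb E|\xi_{ij}|^{2+\ell}\le\bar b^{\ell}$ for $\ell=1,2$; - (C) $\|\xi_{ij}\|_{\psi_1}\le\bar b$; - (D) $\mathbb E[\max_{1\le j\le p}(|\xi_{ij}|/\bar b)^q]\le 1$. Let $$\varpi_{1,n}=\Big(\frac{\log^7(np)}{\underline s}\Big)^{1/6},\qquad \varpi_{2,n}=\Big(\frac{n^{2/q}\log^3(np)}{\gamma^{2/q}\,\underline s}\Big)^{1/3}.$$ *Result.* Suppose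 that $H_1$ holds with change point $m\in[\underline s,n-\underline s]$, that is, $\delta_n\ne0$ and $m\in\{1,\dots,n-1\}$; that $|\delta_n|_\infty\le 1$; and that (A) and (B) hold. Let $\alpha\in(0,1)$, $\zeta\in(0,1/2)$ and $\gamma\in(0,e^{-1})$ with $\log(\gamma^{-1})\le K\log(pn)$ for a constant $K>0$. Consider the signal condition $$|\delta_n|_\infty\ \ge\ C_1\sqrt{\frac{\log(\zeta^{-1})\log(np)+\log(np/\alpha)}{n\,t_m(1-t_m)}}.\tag{1}$$ (i) There are constants $C_1,C_2>0$ depending only on $\underline b,\bar b,K$ such that, if (C) and (1) hold, then $$\mathbb P\big(T_n>q_{T_n^*\mid X_1^n}(1-\alpha)\big)\ \ge\ 1-\gamma-C_2\varpi_{1,n}-2\zeta .$$ (ii) There are constants $C_1,C_2>0$ depending only on $\underline b,\bar b,K,q$ such that, if (D) and (1) hold, then $$\mathbb P\big(T_n>q_{T_n^*\mid X_1^n}(1-\alpha)\big)\ \ge\ 1-\gamma-C_2(\varpi_{1,n}+\varpi_{2,n})-2\zeta .$$ -/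

import Mathlib

open MeasureTheory ProbabilityTheory

namespace CusumTest

noncomputable section

/-! A sample of size `n` in dimension `p` is a function `x : Fin n → Fin p → ℝ`.  The time points
`1, …, n` are represented by `Fin n`, the index `i : Fin n` standing for time `i + 1`; hence
"time `≤ s`" reads `(i : ℕ) < s` and "time `> m`" reads `m ≤ (i : ℕ)`.  The norm of
`Fin p → ℝ` in Mathlib is the maximum norm `|·|_∞`. -/

/-- The average of the first `s` observations. -/
def leftMean {n p : ℕ} (x : Fin n → Fin p → ℝ) (s : ℕ) : Fin p → ℝ :=
  (1 / (s : ℝ)) • ∑ i ∈ Finset.univ.filter (fun i : Fin n => (i : ℕ) < s), x i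

/-- The average of the last `n - s` observations. -/
def rightMean {n p : ℕ} (x : Fin n → Fin p → ℝ) (s : ℕ) : Fin p → ℝ :=
  (1 / ((n : ℝ) - s)) • ∑ i ∈ Finset.univ.filter (fun i : Fin n => s ≤ (i : ℕ)), x i

/-- The CUSUM statistic `Z_n(s)`. -/
def cusum {n p : ℕ} (x : Fin n → Fin p → ℝ) (s : ℕ) : Fin p → ℝ :=
  √((s : ℝ) * ((n : ℝ) - s) / n) • (leftMean x s - rightMean x s)

/-- The integers `s` with `u ≤ s ≤ n - u`, where `u` is the boundary removal parameter. -/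
def interiorTimes (n : ℕ) (u : ℝ) : Finset ℕ :=
  {s ∈ Finset.range (n + 1) | u ≤ (s : ℝ) ∧ (s : ℝ) ≤ (n : ℝ) - u}

/-- The test statistic `T_n = max_{u ≤ s ≤ n - u} |Z_n(s)|_∞`. -/
def cusumStat {n p : ℕ} (u : ℝ) (x : Fin n → Fin p → ℝ) : ℝ :=
  ⨆ s : interiorTimes n u, ‖cusum x s‖

/-- The bootstrap CUSUM statistic `Z_n^*(s)` with multipliers `e`. -/
def bootCusum {n p : ℕ} (x : Fin n → Fin p → ℝ) (e : Fin n → ℝ) (s : ℕ) : Fin p → ℝ :=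
  √(((n : ℝ) - s) / ((n : ℝ) * s)) •
      (∑ i ∈ Finset.univ.filter (fun i : Fin n => (i : ℕ) < s), e i • (x i - leftMean x s)) -
    √((s : ℝ) / ((n : ℝ) * ((n : ℝ) - s))) •
      (∑ i ∈ Finset.univ.filter (fun i : Fin n => s ≤ (i : ℕ)), e i • (x i - rightMean x s))

/-- The bootstrap test statistic `T_n^* = max_{u ≤ s ≤ n - u} |Z_n^*(s)|_∞`. -/
def bootStat {n p : ℕ} (u : ℝ) (x : Fin n → Fin p → ℝ) (e : Fin n → ℝ) : ℝ :=
  ⨆ s : interiorTimes n u, ‖bootCusum x e s‖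

/-- The conditional quantile `inf {t : P(Y ≤ t | X) ≥ β}` of the real random variable `Y` given
`X`, as a random variable.  The conditional law of `Y` given `X` is Mathlib's regular conditional
distribution. -/
def condQuantile {Ω E : Type*} [MeasurableSpace Ω] [MeasurableSpace E] (P : Measure Ω)
    [IsFiniteMeasure P] (Y : Ω → ℝ) (X : Ω → E) (β : ℝ) (ω : Ω) : ℝ :=
  sInf {t : ℝ | β ≤ (condDistrib Y X P (X ω)).real (Set.Iic t)}

/-- The event that the bootstrap CUSUM test of nominal level `α` rejects, that is,
`T_n > q_{T_n^* | X_1^n}(1 - α)`. -/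
def rejectionEvent {Ω : Type*} [MeasurableSpace Ω] (P : Measure Ω) [IsFiniteMeasure P] {n p : ℕ}
    (u α : ℝ) (X : Fin n → Ω → Fin p → ℝ) (e : Fin n → Ω → ℝ) : Set Ω :=
  {ω | condQuantile P (fun ω' => bootStat u (fun i => X i ω') (fun i => e i ω'))
      (fun ω' i => X i ω') (1 - α) ω < cusumStat u (fun i => X i ω)}

/-- The mean-shift model `X_i = μ + δ 1(i > m) + ξ_i`, with i.i.d. mean-zero noise vectors. -/
structure MeanShiftModel {Ω : Type*} [MeasurableSpace Ω] (P : Measure Ω) {n p : ℕ}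
    (X ξ : Fin n → Ω → Fin p → ℝ) (μ δ : Fin p → ℝ) (m : ℕ) : Prop where
  measurable_noise : ∀ i, Measurable (ξ i)
  indep_noise : iIndepFun ξ P
  ident_noise : ∀ i i', IdentDistrib (ξ i) (ξ i') P P
  integrable_noise : ∀ i j, Integrable (fun ω => ξ i ω j) P
  mean_noise : ∀ i j, ∫ ω, ξ i ω j ∂P = 0
  obs_eq : ∀ i ω, X i ω = μ + (if m ≤ (i : ℕ) then δ else 0) + ξ i ω

/-- The alternative hypothesis `H_1` with mean shift `δ` and change point `m`. -/
def Alternative {p : ℕ} (n : ℕ) (δ : Fin p → ℝ) (m : ℕ) : Prop :=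
  δ ≠ 0 ∧ 1 ≤ m ∧ m ≤ n - 1

/-- The multipliers `e_1, …, e_n` are i.i.d. `N(0, 1)` and independent of the sample. -/
structure GaussianMultipliers {Ω : Type*} [MeasurableSpace Ω] (P : Measure Ω) {n p : ℕ}
    (e : Fin n → Ω → ℝ) (X : Fin n → Ω → Fin p → ℝ) : Prop where
  measurable_mult : ∀ i, Measurable (e i)
  law_mult : ∀ i, P.map (e i) = gaussianReal 0 1
  indep_mult : iIndepFun e P
  indep_sample : IndepFun (fun ω i => e i ω) (fun ω i => X i ω) P

/-- The Orlicz (quasi-)norm `‖Y‖_{ψ_β} = inf {C > 0 : E[exp((|Y| / C)^β) - 1] ≤ 1}`, equal to `∞`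
if there is no such `C`. -/
def psiNorm {Ω : Type*} [MeasurableSpace Ω] (P : Measure Ω) (β : ℝ) (Y : Ω → ℝ) : ENNReal :=
  ⨅ (C : ℝ) (_ : 0 < C)
    (_ : ∫⁻ ω, ENNReal.ofReal (Real.exp ((|Y ω| / C) ^ β) - 1) ∂P ≤ 1), ENNReal.ofReal C

/-- Condition (A): the variances of the noise coordinates are at least `bl`. -/
def CondA {Ω : Type*} [MeasurableSpace Ω] (P : Measure Ω) {n p : ℕ}
    (ξ : Fin n → Ω → Fin p → ℝ) (bl : ℝ) : Prop :=
  ∀ i j, bl ≤ variance (fun ω => ξ i ω j) P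

/-- Condition (B): `E|ξ_ij|^(2+ℓ) ≤ bu^ℓ` for `ℓ = 1, 2`. -/
def CondB {Ω : Type*} [MeasurableSpace Ω] (P : Measure Ω) {n p : ℕ}
    (ξ : Fin n → Ω → Fin p → ℝ) (bu : ℝ) : Prop :=
  ∀ ℓ : ℕ, ℓ = 1 ∨ ℓ = 2 → ∀ i j, Integrable (fun ω => |ξ i ω j| ^ (2 + ℓ)) P ∧
    ∫ ω, |ξ i ω j| ^ (2 + ℓ) ∂P ≤ bu ^ ℓ

/-- Condition (C): `‖ξ_ij‖_{ψ_1} ≤ bu`. -/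
def CondC {Ω : Type*} [MeasurableSpace Ω] (P : Measure Ω) {n p : ℕ}
    (ξ : Fin n → Ω → Fin p → ℝ) (bu : ℝ) : Prop :=
  ∀ i j, psiNorm P 1 (fun ω => ξ i ω j) ≤ ENNReal.ofReal bu

/-- Condition (D): `E[max_j (|ξ_ij| / bu)^q] ≤ 1`. -/
def CondD {Ω : Type*} [MeasurableSpace Ω] (P : Measure Ω) {n p : ℕ}
    (ξ : Fin n → Ω → Fin p → ℝ) (bu q : ℝ) : Prop :=
  ∀ i, ∫⁻ ω, ⨆ j, ENNReal.ofReal ((|ξ i ω j| / bu) ^ q) ∂P ≤ 1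

/-- The rate `ϖ_{1,n} = (log^7(np) / u)^{1/6}`. -/
def rateOne (n p : ℕ) (u : ℝ) : ℝ :=
  (Real.log ((n : ℝ) * p) ^ 7 / u) ^ (1 / 6 : ℝ)

/-- The rate `ϖ_{2,n} = (n^{2/q} log^3(np) / (γ^{2/q} u))^{1/3}`. -/
def rateTwo (n p : ℕ) (u γ q : ℝ) : ℝ :=
  ((n : ℝ) ^ (2 / q) * Real.log ((n : ℝ) * p) ^ 3 / (γ ^ (2 / q) * u)) ^ (1 / 3 : ℝ)

/-- The signal threshold
`√((log(1/ζ) log(np) + log(np/α)) / (n t_m (1 - t_m)))`, where `t_m = m / n`. -/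
def signalThreshold (n p m : ℕ) (ζ α : ℝ) : ℝ :=
  √((Real.log ζ⁻¹ * Real.log ((n : ℝ) * p) + Real.log ((n : ℝ) * p / α)) /
    ((n : ℝ) * ((m : ℝ) / n) * (1 - (m : ℝ) / n)))

end

end CusumTest

/-! ### Conditional laws and exponential tail bounds. -/

namespace CusumTest

/-! No Gaussian approximation is needed: it suffices that `T_n` is large and the bootstrap quantile
is not, and both follow from crude exponential bounds. Put `b = log(np)` and let `V` bound the
second moments of the noise.

Suppose the noise is bounded by `L` outside an event of probability `ρ`, with `3 L² b ≤ u`. Chernoff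
bounds restricted to the event of bounded noise give, each up to probability `1/(np)`: the noise
part of `Z_n(m)` is at most `(V+2)√b`, and all left and right averages of squared noise are at most
`2V+1`. Since `|δ|_∞ ≤ 1`, the second fact bounds the conditional variances of `Z_n^*` by `A =
4V+4`, so a Gaussian union bound puts the quantile below `√(2A log(2np/α))`. The drift of `Z_n(m)`
exceeds the sum of the two bounds under the signal condition. This is
`le_measureReal_rejectionEvent`.

Under (C), `L` is of order `b` and `ρ = 1/(np)`; under (D), `L` is of order `(n/γ)^(1/q)` and `ρ =
γ`. If `C₂` times the rate exceeds `1`, the claim is trivial; otherwise the rate supplies `3 L² b ≤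
u`. The errors `1/(np)` are absorbed by `ϖ_{1,n}`, and `2ζ` is pure slack. -/

/-- If `Y = f (X, E)` with `E` independent of `X`, the conditional law of `Y` given `X = x` is
the law of `f (x, E)`. -/
theorem condDistrib_ae_eq_map_of_indepFun {Ω A B : Type*} [MeasurableSpace Ω] [MeasurableSpace A]
    [MeasurableSpace B] {P : Measure Ω} [IsProbabilityMeasure P] {X : Ω → A} {E : Ω → B}
    (hX : Measurable X) (hE : Measurable E) (hind : IndepFun X E P) {f : A × B → ℝ}
    (hf : Measurable f) :
    ∀ᵐ ω ∂P, condDistrib (fun ω' => f (X ω', E ω')) X P (X ω) =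
      P.map (fun ω' => f (X ω, E ω')) := by
  have : IsProbabilityMeasure (P.map E) := Measure.isProbabilityMeasure_map hE.aemeasurable
  let κ : Kernel A ℝ := (Kernel.id ×ₖ Kernel.const A (P.map E)).map f
  have hκa : ∀ x, κ x = P.map (fun ω' => f (x, E ω')) := by
    intro x
    have hfx : Measurable fun b => f (x, b) := hf.comp measurable_prodMk_left
    simp only [κ]
    rw [Kernel.map_apply _ hf, Kernel.prod_apply, Kernel.id_apply, Kernel.const_apply,
      Measure.dirac_prod, Measure.map_map hf measurable_prodMk_left]
    exact Measure.map_map hfx hE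
  have key : condDistrib (fun ω' => f (X ω', E ω')) X P =ᵐ[P.map X] κ := by
    have : IsMarkovKernel κ := Kernel.IsMarkovKernel.map _ hf
    apply condDistrib_ae_eq_of_measure_eq_compProd_of_measurable hX (hf.comp (hX.prodMk hE))
    ext s hs
    have hg : Measurable fun z : A × B => (z.1, f z) := measurable_fst.prodMk hf
    have h1 : P.map (fun x => (X x, f (X x, E x))) =
        ((P.map X).prod (P.map E)).map fun z : A × B => (z.1, f z) := by
      rw [← (indepFun_iff_map_prod_eq_prod_map_map hX.aemeasurable hE.aemeasurable).1 hind,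
        Measure.map_map hg (hX.prodMk hE)]
      rfl
    refine (congrArg (fun ν => ν s) h1).trans ?_
    rw [Measure.map_apply hg hs, Measure.prod_apply (hg hs), Measure.compProd_apply hs]
    refine lintegral_congr fun x => ?_
    have hfx : Measurable fun ω' => f (x, E ω') := (hf.comp measurable_prodMk_left).comp hE
    rw [hκa, Measure.map_apply hfx (measurable_prodMk_left hs),
      Measure.map_apply hE (measurable_prodMk_left (hg hs))]
    rfl
  filter_upwards [ae_of_ae_map hX.aemeasurable key] with ω hω
  rw [hω, hκa]

/-- Chernoff bound for sums of independent variables on the event that no summand exceeds `1` in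
absolute value. -/
theorem measure_abs_le_one_and_le_sum {Ω ι : Type*} [MeasurableSpace Ω] [Fintype ι]
    {P : Measure Ω} {Y : ι → Ω → ℝ} (hY : ∀ i, Measurable (Y i))
    (hind : iIndepFun Y P) (G : ι → Ω → ℝ) (B : ι → ℝ) (hG : ∀ i, Integrable (G i) P)
    (hG0 : ∀ i ω, 0 ≤ G i ω) (hYG : ∀ i ω, |Y i ω| ≤ 1 → Real.exp (Y i ω) ≤ G i ω)
    (hGB : ∀ i, ∫ ω, G i ω ∂P ≤ Real.exp (B i)) (x : ℝ) :
    P {ω | (∀ i, |Y i ω| ≤ 1) ∧ x ≤ ∑ i, Y i ω} ≤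
      ENNReal.ofReal (Real.exp (∑ i, B i - x)) := by
  -- Truncating the exponential rather than the summand keeps the product structure: on the event
  -- the product of the `f (Y i)` is the exponential of the sum.
  let f : ℝ → ENNReal := fun y => if |y| ≤ 1 then ENNReal.ofReal (Real.exp y) else 0
  have hf : Measurable f := Measurable.ite (measurableSet_le (by fun_prop) (by fun_prop))
    (by fun_prop) measurable_const
  have hprod : ∫⁻ ω, ∏ i, f (Y i ω) ∂P = ∏ i, ∫⁻ ω, f (Y i ω) ∂P :=
    lintegral_prod_eq_prod_lintegral_of_indepFun Finset.univ (fun i ω => f (Y i ω))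
      (hind.comp (fun _ => f) fun _ => hf) fun i => hf.comp (hY i)
  have hle : ∫⁻ ω, ∏ i, f (Y i ω) ∂P ≤ ENNReal.ofReal (Real.exp (∑ i, B i)) := by
    rw [hprod, Real.exp_sum, ENNReal.ofReal_prod_of_nonneg fun i _ => (Real.exp_pos _).le]
    refine Finset.prod_le_prod' fun i _ => ?_
    refine le_trans (lintegral_mono fun ω => ?_)
      (le_trans (ofReal_integral_eq_lintegral_ofReal (hG i) (ae_of_all _ (hG0 i))).symm.le
        (ENNReal.ofReal_le_ofReal (hGB i)))
    dsimp only [f]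
    split_ifs with h
    · exact ENNReal.ofReal_le_ofReal (hYG i ω h)
    · exact zero_le
  have hsub : {ω | (∀ i, |Y i ω| ≤ 1) ∧ x ≤ ∑ i, Y i ω} ⊆
      {ω | ENNReal.ofReal (Real.exp x) ≤ ∏ i, f (Y i ω)} := by
    rintro ω ⟨h1, h2⟩
    have : ∏ i, f (Y i ω) = ENNReal.ofReal (Real.exp (∑ i, Y i ω)) := by
      rw [Real.exp_sum, ENNReal.ofReal_prod_of_nonneg fun i _ => (Real.exp_pos _).le]
      exact Finset.prod_congr rfl fun i _ => if_pos (h1 i)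
    rw [Set.mem_ofPred_eq, this]
    exact ENNReal.ofReal_le_ofReal (Real.exp_le_exp.2 h2)
  refine (measure_mono hsub).trans ?_
  refine (meas_ge_le_lintegral_div
    (Finset.measurable_fun_prod _ fun i _ => hf.comp (hY i)).aemeasurable
    (by simpa using Real.exp_pos x) ENNReal.ofReal_ne_top).trans ?_
  rw [Real.exp_sub, ENNReal.ofReal_div_of_pos (Real.exp_pos x)]
  exact ENNReal.div_le_div_right hle _

variable {Ω : Type*} [MeasurableSpace Ω] {P : Measure Ω} [IsProbabilityMeasure P]

/-- Upper tail of a weighted sum of centred independent variables, without truncation bias. -/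
theorem measure_le_weighted_sum {ι : Type*} [Fintype ι] {ξ : ι → Ω → ℝ}
    (hξ : ∀ i, Measurable (ξ i)) (hind : iIndepFun ξ P) (h1 : ∀ i, Integrable (ξ i) P)
    (h2 : ∀ i, Integrable (fun ω => ξ i ω ^ 2) P) (hmean : ∀ i, ∫ ω, ξ i ω ∂P = 0) {V : ℝ}
    (hV : ∀ i, ∫ ω, ξ i ω ^ 2 ∂P ≤ V) (c : ι → ℝ) (x : ℝ) :
    P {ω | (∀ i, |c i * ξ i ω| ≤ 1) ∧ x ≤ ∑ i, c i * ξ i ω} ≤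
      ENNReal.ofReal (Real.exp (V * ∑ i, c i ^ 2 - x)) := by
  have hI : ∀ i, Integrable (fun ω => 1 + c i * ξ i ω + c i ^ 2 * ξ i ω ^ 2) P := fun i =>
    ((integrable_const _).add ((h1 i).const_mul _)).add ((h2 i).const_mul _)
  have := measure_abs_le_one_and_le_sum (P := P) (Y := fun i ω => c i * ξ i ω)
    (fun i => (hξ i).const_mul _)
    (hind.comp (fun i y => c i * y) fun i => measurable_const_mul _)
    -- `1 + y + y²` dominates `exp y` for `|y| ≤ 1` and is nonnegative everywhere. It is integrated
    -- over the whole space, so the linear term has mean exactly zero.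
    (fun i ω => 1 + c i * ξ i ω + c i ^ 2 * ξ i ω ^ 2) (fun i => V * c i ^ 2) hI
    (fun i ω => by nlinarith [sq_nonneg (1 + c i * ξ i ω), sq_nonneg (c i * ξ i ω)])
    (fun i ω h => by
      have := (abs_le.1 (Real.abs_exp_sub_one_sub_id_le h)).2
      nlinarith)
    (fun i => by
      have hadd : Integrable (fun ω => 1 + c i * ξ i ω) P :=
        (integrable_const _).add ((h1 i).const_mul _)
      rw [integral_add hadd ((h2 i).const_mul _),
        integral_add (integrable_const _) ((h1 i).const_mul _), integral_const_mul,
        integral_const_mul, hmean i]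
      have := mul_le_mul_of_nonneg_left (hV i) (sq_nonneg (c i))
      have := Real.add_one_le_exp (V * c i ^ 2)
      simp
      linarith) x
  rwa [← Finset.mul_sum] at this

/-- Upper tail of a weighted sum of squares of independent variables. -/
theorem measure_le_weighted_sum_sq {ι : Type*} [Fintype ι] {ξ : ι → Ω → ℝ}
    (hξ : ∀ i, Measurable (ξ i)) (hind : iIndepFun ξ P)
    (h2 : ∀ i, Integrable (fun ω => ξ i ω ^ 2) P) {V : ℝ}
    (hV : ∀ i, ∫ ω, ξ i ω ^ 2 ∂P ≤ V) (c : ι → ℝ) (hc : ∀ i, 0 ≤ c i) (x : ℝ) :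
    P {ω | (∀ i, |c i * ξ i ω ^ 2| ≤ 1) ∧ x ≤ ∑ i, c i * ξ i ω ^ 2} ≤
      ENNReal.ofReal (Real.exp (2 * V * ∑ i, c i - x)) := by
  have h0 : ∀ i ω, 0 ≤ c i * ξ i ω ^ 2 := fun i ω => mul_nonneg (hc i) (sq_nonneg _)
  have := measure_abs_le_one_and_le_sum (P := P) (Y := fun i ω => c i * ξ i ω ^ 2)
    (fun i => ((hξ i).pow_const 2).const_mul _)
    (hind.comp (fun i y => c i * y ^ 2) fun i => by fun_prop)
    -- Here `0 ≤ y ≤ 1` on the event, so `exp y ≤ 1 + y + y² ≤ 1 + 2y`, and second moments suffice.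
    (fun i ω => 1 + 2 * c i * ξ i ω ^ 2) (fun i => 2 * V * c i)
    (fun i => (integrable_const _).add ((h2 i).const_mul _))
    (fun i ω => by nlinarith [h0 i ω])
    (fun i ω h => by
      have := (abs_le.1 (Real.abs_exp_sub_one_sub_id_le h)).2
      nlinarith [h0 i ω, (abs_le.1 h).2])
    (fun i => by
      rw [integral_add (integrable_const _) ((h2 i).const_mul _), integral_const_mul]
      have := mul_le_mul_of_nonneg_left (hV i) (hc i)
      have := Real.add_one_le_exp (2 * V * c i)
      simp
      linarith) x
  rwa [← Finset.mul_sum] at this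

/-- Tail of a linear combination of independent standard Gaussian variables. -/
theorem measureReal_le_abs_gaussian_sum {ι : Type*} [Fintype ι] {e : ι → Ω → ℝ}
    (he : ∀ i, P.map (e i) = gaussianReal 0 1)
    (hind : iIndepFun e P) (c : ι → ℝ) {A t : ℝ} (hA : 0 < A) (hc : ∑ i, c i ^ 2 ≤ A)
    (ht : 0 < t) :
    P.real {ω | t ≤ |∑ i, c i * e i ω|} ≤ 2 * Real.exp (-t ^ 2 / (2 * A)) := by
  have hsub : ∀ (i : ι) (r : ℝ), HasSubgaussianMGF (fun ω => r * e i ω) (r ^ 2).toNNReal P :=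
    fun i r =>
    { integrable_exp_mul := fun t => by
        have hm : AEMeasurable (e i) P := aemeasurable_of_map_neZero (by rw [he]; infer_instance)
        have := integrable_exp_mul_gaussianReal (μ := 0) (v := 1) (t * r)
        rw [← he i] at this
        simpa only [Function.comp_def, mul_assoc] using this.comp_aemeasurable hm
      mgf_le := fun t => by
        rw [mgf_const_mul, mgf_gaussianReal (he i), Real.coe_toNNReal _ (sq_nonneg r)]
        apply le_of_eq
        congr 1
        push_cast
        ring }
  have one : ∀ c : ι → ℝ, ∑ i, c i ^ 2 ≤ A →
      P.real {ω | t ≤ ∑ i, c i * e i ω} ≤ Real.exp (-t ^ 2 / (2 * A)) := by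
    intro c hc
    have hs := HasSubgaussianMGF.sum_of_iIndepFun (s := Finset.univ)
      (hind.comp (fun i y => c i * y) fun i => measurable_const_mul _)
      (fun i _ => hsub i (c i))
    have hA' : ((∑ i, (c i ^ 2).toNNReal : NNReal) : ℝ) ≤ A := by
      push_cast
      simpa [Real.coe_toNNReal _ (sq_nonneg _)] using hc
    have hs' : HasSubgaussianMGF (fun ω => ∑ i, c i * e i ω) ⟨A, hA.le⟩ P :=
      { integrable_exp_mul := hs.integrable_exp_mul
        mgf_le := fun r => (hs.mgf_le r).trans (by
          apply Real.exp_le_exp.2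
          have := mul_le_mul_of_nonneg_right hA' (sq_nonneg r)
          exact div_le_div_of_nonneg_right this two_pos.le) }
    exact hs'.measure_ge_le ht.le
  have hsubset : {ω | t ≤ |∑ i, c i * e i ω|} ⊆
      {ω | t ≤ ∑ i, c i * e i ω} ∪ {ω | t ≤ ∑ i, -c i * e i ω} := by
    intro ω h
    rcases le_abs.1 (show t ≤ |∑ i, c i * e i ω| from h) with h | h
    · exact Or.inl h
    · right
      simpa [Finset.sum_neg_distrib] using! h
  refine (measureReal_mono hsubset).trans ((measureReal_union_le _ _).trans ?_)
  have := one c hc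
  have := one (fun i => -c i) (by simpa using hc)
  linarith

end CusumTest

/-! ### Splitting the sample at a time point. -/

namespace CusumTest

theorem card_filter_val_lt {n s : ℕ} (hs : s ≤ n) :
    (Finset.univ.filter fun i : Fin n => (i : ℕ) < s).card = s := by
  rw [Fin.card_filter_val_lt, min_eq_right hs]

theorem card_filter_le_val {n s : ℕ} (hs : s ≤ n) :
    (Finset.univ.filter fun i : Fin n => s ≤ (i : ℕ)).card = n - s := by
  have h := Finset.card_filter_add_card_filter_not (s := Finset.univ) fun i : Fin n => (i : ℕ) < s
  simp only [not_lt, Finset.card_univ, Fintype.card_fin] at h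
  rw [card_filter_val_lt hs] at h
  omega

theorem sum_ite_val_lt {n : ℕ} (s : ℕ) (f g : Fin n → ℝ) :
    ∑ i : Fin n, (if (i : ℕ) < s then f i else g i) =
      ∑ i ∈ Finset.univ.filter (fun i : Fin n => (i : ℕ) < s), f i +
        ∑ i ∈ Finset.univ.filter (fun i : Fin n => s ≤ (i : ℕ)), g i := by
  rw [Finset.sum_ite]
  simp only [not_lt]

/-- The mean minimises the sum of squared deviations. This lets the random segment means in the
bootstrap variance be replaced by the fixed centre `μ`. -/
theorem sum_sq_sub_mean_le {ι : Type*} (S : Finset ι) (y : ι → ℝ) {k : ℝ} (hk : (S.card : ℝ) = k)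
    (c : ℝ) :
    ∑ i ∈ S, (y i - 1 / k * ∑ l ∈ S, y l) ^ 2 ≤ ∑ i ∈ S, (y i - c) ^ 2 := by
  subst hk
  rcases S.eq_empty_or_nonempty with rfl | hS
  · simp
  have hk : (0 : ℝ) < S.card := by exact_mod_cast hS.card_pos
  set a : ℝ := 1 / (S.card : ℝ) * ∑ l ∈ S, y l with ha
  have hsum : ∑ l ∈ S, y l = S.card * a := by rw [ha]; field_simp
  have h : ∑ i ∈ S, (y i - c) ^ 2 =
      ∑ i ∈ S, (y i - a) ^ 2 + S.card * (a - c) ^ 2 + 2 * (a - c) * ∑ i ∈ S, (y i - a) := by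
    rw [Finset.mul_sum, ← nsmul_eq_mul, ← Finset.sum_const, ← Finset.sum_add_distrib,
      ← Finset.sum_add_distrib]
    exact Finset.sum_congr rfl fun i _ => by ring
  rw [Finset.sum_sub_distrib, hsum, Finset.sum_const, nsmul_eq_mul, sub_self, mul_zero,
    add_zero] at h
  rw [h]
  nlinarith [mul_nonneg hk.le (sq_nonneg (a - c))]

theorem mem_interiorTimes {n s : ℕ} {u : ℝ} (hu : 1 ≤ u) (hs : s ∈ interiorTimes n u) :
    1 ≤ s ∧ s + 1 ≤ n ∧ u ≤ s ∧ u ≤ (n : ℝ) - s := by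
  simp only [interiorTimes, Finset.mem_filter, Finset.mem_range] at hs
  obtain ⟨-, h1, h2⟩ := hs
  have h3 : (1 : ℝ) ≤ s := hu.trans h1
  have h4 : (s : ℝ) + 1 ≤ n := by linarith
  exact ⟨by exact_mod_cast h3, by exact_mod_cast h4, h1, by linarith⟩

theorem card_interiorTimes_le {n : ℕ} {u : ℝ} (hu : 1 ≤ u) : (interiorTimes n u).card ≤ n := by
  have : interiorTimes n u ⊆ Finset.Icc 1 n := fun s hs => by
    have := mem_interiorTimes hu hs
    rw [Finset.mem_Icc]
    omega
  simpa using Finset.card_le_card this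

/-! ### The bootstrap statistic as a linear form in the multipliers -/

/-- The coefficient of the `i`-th multiplier in the `j`-th coordinate of `Z_n^*(s)`. -/
noncomputable def bootCoeff {n p : ℕ} (x : Fin n → Fin p → ℝ) (s : ℕ) (j : Fin p) (i : Fin n) : ℝ :=
  if (i : ℕ) < s then √(((n : ℝ) - s) / ((n : ℝ) * s)) * (x i j - leftMean x s j)
  else -(√((s : ℝ) / ((n : ℝ) * ((n : ℝ) - s))) * (x i j - rightMean x s j))

theorem bootCusum_apply {n p : ℕ} (x : Fin n → Fin p → ℝ) (e : Fin n → ℝ) (s : ℕ) (j : Fin p) :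
    bootCusum x e s j = ∑ i, bootCoeff x s j i * e i := by
  simp only [bootCoeff, ite_mul, sum_ite_val_lt]
  simp only [bootCusum, Pi.sub_apply, Pi.smul_apply, Finset.sum_apply, smul_eq_mul]
  rw [sub_eq_add_neg, Finset.mul_sum, Finset.mul_sum, ← Finset.sum_neg_distrib]
  congr 1 <;> exact Finset.sum_congr rfl fun i _ => by ring

/-- The variance of a coordinate of `Z_n^*(s)` is a convex combination, with weights `(n-s)/n` and
`s/n`, of the empirical variances of the two segments. -/
theorem sum_bootCoeff_sq_le {n p : ℕ} (x : Fin n → Fin p → ℝ) {s : ℕ} (hs : 1 ≤ s)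
    (hsn : s + 1 ≤ n) (j : Fin p) {A c : ℝ}
    (h1 : ∑ i ∈ Finset.univ.filter (fun i : Fin n => (i : ℕ) < s), (x i j - c) ^ 2 ≤ s * A)
    (h2 : ∑ i ∈ Finset.univ.filter (fun i : Fin n => s ≤ (i : ℕ)), (x i j - c) ^ 2 ≤
      ((n : ℝ) - s) * A) :
    ∑ i, bootCoeff x s j i ^ 2 ≤ A := by
  have hs0 : (0 : ℝ) < s := by exact_mod_cast hs
  have hns : (0 : ℝ) < (n : ℝ) - s := by
    have : (s : ℝ) + 1 ≤ n := by exact_mod_cast hsn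
    linarith
  have hn : (0 : ℝ) < n := by linarith
  have hc1 := card_filter_val_lt (show s ≤ n by omega)
  have hc2 : ((Finset.univ.filter fun i : Fin n => s ≤ (i : ℕ)).card : ℝ) = (n : ℝ) - s := by
    rw [card_filter_le_val (by omega), Nat.cast_sub (by omega)]
  have e1 := (sum_sq_sub_mean_le _ (fun i => x i j) (congrArg (Nat.cast (R := ℝ)) hc1) c).trans h1
  have e2 := (sum_sq_sub_mean_le _ (fun i => x i j) hc2 c).trans h2
  have hsplit : ∑ i, bootCoeff x s j i ^ 2 =
      ((n : ℝ) - s) / (n * s) * ∑ i ∈ Finset.univ.filter (fun i : Fin n => (i : ℕ) < s),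
          (x i j - leftMean x s j) ^ 2 +
        (s : ℝ) / (n * (n - s)) * ∑ i ∈ Finset.univ.filter (fun i : Fin n => s ≤ (i : ℕ)),
          (x i j - rightMean x s j) ^ 2 := by
    simp only [bootCoeff, ite_pow, sum_ite_val_lt, neg_sq, mul_pow, ← Finset.mul_sum]
    rw [Real.sq_sqrt (by positivity), Real.sq_sqrt (by positivity)]
  rw [hsplit]
  simp only [leftMean, rightMean, Pi.smul_apply, Finset.sum_apply, smul_eq_mul]
  have f1 := mul_le_mul_of_nonneg_left e1 (show 0 ≤ ((n : ℝ) - s) / (n * s) by positivity)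
  have f2 := mul_le_mul_of_nonneg_left e2 (show 0 ≤ (s : ℝ) / (n * (n - s)) by positivity)
  refine (add_le_add f1 f2).trans (le_of_eq ?_)
  field_simp
  ring

theorem bootStat_nonneg {n p : ℕ} (u : ℝ) (x : Fin n → Fin p → ℝ) (e : Fin n → ℝ) :
    0 ≤ bootStat u x e :=
  Real.iSup_nonneg fun _ => norm_nonneg _

theorem measurable_bootStat (n p : ℕ) (u : ℝ) :
    Measurable fun z : (Fin n → Fin p → ℝ) × (Fin n → ℝ) => bootStat u z.1 z.2 := by
  unfold bootStat
  refine Measurable.iSup fun s => Continuous.measurable ?_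
  unfold bootCusum leftMean rightMean
  fun_prop

theorem measurable_bootStat_right {n p : ℕ} (u : ℝ) (x : Fin n → Fin p → ℝ) :
    Measurable (bootStat u x) := by
  unfold bootStat
  refine Measurable.iSup fun s => Continuous.measurable ?_
  unfold bootCusum
  fun_prop

theorem exists_lt_of_lt_bootStat {n p : ℕ} {u t : ℝ} (ht : 0 ≤ t) {x : Fin n → Fin p → ℝ}
    {e : Fin n → ℝ} (h : t < bootStat u x e) :
    ∃ s ∈ interiorTimes n u, ∃ j, t < |bootCusum x e s j| := by
  by_contra! hcon
  refine h.not_ge (Real.iSup_le (fun s => ?_) ht)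
  exact (pi_norm_le_iff_of_nonneg ht).2 fun j => hcon s s.2 j

section

variable {Ω : Type*} [MeasurableSpace Ω] {P : Measure Ω} [IsProbabilityMeasure P]

/-- For a fixed sample the process is Gaussian in the multipliers. A union bound over at most `np`
pairs `(s, j)`, each contributing `2 · α/(2np)`, fixes the level. -/
theorem measureReal_lt_bootStat_le {n p : ℕ} {e : Fin n → Ω → ℝ}
    (he : ∀ i, P.map (e i) = gaussianReal 0 1) (hind : iIndepFun e P) {u α A : ℝ} (hu : 1 ≤ u)
    (hα : 0 < α) (hα1 : α < 1) (hA : 0 < A) (hn : 1 ≤ n) (hp : 1 ≤ p) (x : Fin n → Fin p → ℝ)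
    (hx : ∀ s ∈ interiorTimes n u, ∀ j, ∑ i, bootCoeff x s j i ^ 2 ≤ A) :
    P.real {ω | √(2 * A * Real.log (2 * n * p / α)) < bootStat u x fun i => e i ω} ≤ α := by
  have hn' : (1 : ℝ) ≤ n := by exact_mod_cast hn
  have hp' : (1 : ℝ) ≤ p := by exact_mod_cast hp
  have hlog : 0 < Real.log (2 * n * p / α) := by
    apply Real.log_pos
    rw [lt_div_iff₀ hα]
    nlinarith
  set t := √(2 * A * Real.log (2 * n * p / α)) with ht
  have ht0 : 0 < t := Real.sqrt_pos.2 (by positivity)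
  have hsub : {ω | t < bootStat u x fun i => e i ω} ⊆
      ⋃ q ∈ interiorTimes n u ×ˢ (Finset.univ : Finset (Fin p)),
        {ω | t ≤ |∑ i, bootCoeff x q.1 q.2 i * e i ω|} := by
    intro ω hω
    obtain ⟨s, hs, j, h⟩ := exists_lt_of_lt_bootStat ht0.le
      (show t < bootStat u x fun i => e i ω from hω)
    rw [bootCusum_apply] at h
    refine Set.mem_iUnion₂.2 ⟨(s, j), by simpa using hs, h.le⟩
  have hexp : Real.exp (-t ^ 2 / (2 * A)) = α / (2 * n * p) := by
    have : -t ^ 2 / (2 * A) = -Real.log (2 * n * p / α) := by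
      rw [ht, Real.sq_sqrt (by positivity)]
      field_simp
    rw [this, Real.exp_neg, Real.exp_log (by positivity), inv_div]
  refine (measureReal_mono hsub (measure_ne_top _ _)).trans
    ((measureReal_biUnion_finset_le _ _).trans ?_)
  refine (Finset.sum_le_card_nsmul _ _ (2 * (α / (2 * n * p))) fun q hq => ?_).trans ?_
  · rw [← hexp]
    exact measureReal_le_abs_gaussian_sum he hind _ hA
      (hx q.1 (Finset.mem_product.1 hq).1 q.2) ht0
  · rw [Finset.card_product, Finset.card_univ, Fintype.card_fin, nsmul_eq_mul]
    have hc : ((interiorTimes n u).card : ℝ) ≤ n := by exact_mod_cast card_interiorTimes_le hu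
    have : ((interiorTimes n u).card : ℝ) * p * (2 * (α / (2 * n * p))) ≤
        n * p * (2 * (α / (2 * n * p))) := by gcongr
    push_cast
    refine this.trans (le_of_eq ?_)
    field_simp

theorem sInf_quantile_le {Z : Ω → ℝ} (hZ : Measurable Z) (hZ0 : ∀ ω, 0 ≤ Z ω) {α t : ℝ}
    (hα : α < 1) (h : P.real {ω | t < Z ω} ≤ α) :
    sInf {r | 1 - α ≤ (P.map Z).real (Set.Iic r)} ≤ t := by
  -- A real infimum needs a lower bound: since `Z ≥ 0` and `1 - α > 0`, no negative `r` qualifies.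
  refine csInf_le ⟨0, fun r hr => ?_⟩ ?_
  · by_contra! hneg
    have h1 : 1 - α ≤ (P.map Z).real (Set.Iic r) := hr
    rw [map_measureReal_apply hZ measurableSet_Iic] at h1
    have h2 : Z ⁻¹' Set.Iic r = ∅ :=
      Set.eq_empty_of_forall_notMem fun ω' h => by
        have h3 : Z ω' ≤ r := h
        linarith [hZ0 ω']
    rw [h2, measureReal_empty] at h1
    linarith
  · change 1 - α ≤ (P.map Z).real (Set.Iic t)
    rw [map_measureReal_apply hZ measurableSet_Iic]
    have hc := probReal_compl_eq_one_sub (μ := P) (hZ (measurableSet_Iic (a := t)))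
    have hset : {ω' | t < Z ω'} = (Z ⁻¹' Set.Iic t)ᶜ := by
      ext ω'
      simp
    rw [hset, hc] at h
    linarith

/-- Almost surely, the bootstrap quantile is at most `√(2 A log(2np/α))` whenever all conditional
variances of the bootstrap process are at most `A`. -/
theorem ae_condQuantile_le {n p : ℕ} {X : Fin n → Ω → Fin p → ℝ} {e : Fin n → Ω → ℝ}
    (hX : ∀ i, Measurable (X i)) (he : GaussianMultipliers P e X) {u α A : ℝ} (hu : 1 ≤ u)
    (hα : 0 < α) (hα1 : α < 1) (hA : 0 < A) (hn : 1 ≤ n) (hp : 1 ≤ p) :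
    ∀ᵐ ω ∂P, (∀ s ∈ interiorTimes n u, ∀ j, ∑ i, bootCoeff (fun i => X i ω) s j i ^ 2 ≤ A) →
      condQuantile P (fun ω' => bootStat u (fun i => X i ω') (fun i => e i ω'))
        (fun ω' i => X i ω') (1 - α) ω ≤ √(2 * A * Real.log (2 * n * p / α)) := by
  have hXm : Measurable fun ω i => X i ω := measurable_pi_lambda _ hX
  have hem : Measurable fun ω i => e i ω := measurable_pi_lambda _ he.measurable_mult
  have hcond : ∀ᵐ ω ∂P, condDistrib (fun ω' => bootStat u (fun i => X i ω') (fun i => e i ω'))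
      (fun ω' i => X i ω') P (fun i => X i ω) =
        P.map (fun ω' => bootStat u (fun i => X i ω) (fun i => e i ω')) :=
    condDistrib_ae_eq_map_of_indepFun hXm hem he.indep_sample.symm (measurable_bootStat n p u)
  refine hcond.mono fun ω hω hx => ?_
  unfold condQuantile
  rw [hω]
  exact sInf_quantile_le ((measurable_bootStat_right u fun i => X i ω).comp hem)
    (fun ω' => bootStat_nonneg _ _ _) hα1
    (measureReal_lt_bootStat_le he.law_mult he.indep_mult hu hα hα1 hA hn hp
      (fun i => X i ω) hx)

end

/-! ### The CUSUM statistic at the change point -/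

/-- The coefficient of the `i`-th observation in `Z_n(s)`. -/
noncomputable def cusumCoeff (n s : ℕ) (i : Fin n) : ℝ :=
  if (i : ℕ) < s then √((s : ℝ) * ((n : ℝ) - s) / n) / s
  else -(√((s : ℝ) * ((n : ℝ) - s) / n) / ((n : ℝ) - s))

theorem cusum_apply {n p : ℕ} (x : Fin n → Fin p → ℝ) (s : ℕ) (j : Fin p) :
    cusum x s j = ∑ i, cusumCoeff n s i * x i j := by
  simp only [cusumCoeff, ite_mul, sum_ite_val_lt]
  simp only [cusum, leftMean, rightMean, Pi.sub_apply, Pi.smul_apply, Finset.sum_apply,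
    smul_eq_mul, Finset.mul_sum]
  rw [mul_sub, sub_eq_add_neg, Finset.mul_sum, Finset.mul_sum, ← Finset.sum_neg_distrib]
  congr 1 <;> exact Finset.sum_congr rfl fun i _ => by ring

theorem cusumCoeff_sq {n s : ℕ} (hs : (0 : ℝ) < s) (hns : (0 : ℝ) < (n : ℝ) - s) (i : Fin n) :
    cusumCoeff n s i ^ 2 = if (i : ℕ) < s then ((n : ℝ) - s) / (n * s)
      else (s : ℝ) / (n * (n - s)) := by
  have hn : (0 : ℝ) < n := by linarith
  simp only [cusumCoeff, ite_pow, neg_sq, div_pow]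
  rw [Real.sq_sqrt (by positivity)]
  congr 1 <;> field_simp

theorem sum_cusumCoeff_sq {n s : ℕ} (hs : 1 ≤ s) (hsn : s + 1 ≤ n) :
    ∑ i, cusumCoeff n s i ^ 2 = 1 := by
  have hs0 : (0 : ℝ) < s := by exact_mod_cast hs
  have hns : (0 : ℝ) < (n : ℝ) - s := by
    have : (s : ℝ) + 1 ≤ n := by exact_mod_cast hsn
    linarith
  have hn : (0 : ℝ) < n := by linarith
  simp only [cusumCoeff_sq hs0 hns, sum_ite_val_lt, Finset.sum_const, nsmul_eq_mul]
  rw [card_filter_val_lt (by omega), card_filter_le_val (by omega), Nat.cast_sub (by omega)]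
  field_simp
  ring

/-- Boundary removal keeps any single observation from dominating; this makes the truncation level
in the Chernoff bound admissible. -/
theorem cusumCoeff_sq_le {n s : ℕ} {u : ℝ} (hu : 0 < u) (hs : u ≤ s) (hns : u ≤ (n : ℝ) - s)
    (i : Fin n) : cusumCoeff n s i ^ 2 ≤ 1 / u := by
  have hs0 : (0 : ℝ) < s := by linarith
  have hns0 : (0 : ℝ) < (n : ℝ) - s := by linarith
  have hn : (0 : ℝ) < n := by linarith
  rw [cusumCoeff_sq hs0 hns0]
  split_ifs
  · rw [div_le_div_iff₀ (by positivity) hu]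
    nlinarith
  · rw [div_le_div_iff₀ (by positivity) hu]
    nlinarith

theorem cusum_eq_of_shift {n p m : ℕ} {x ξ : Fin n → Fin p → ℝ} {μ δ : Fin p → ℝ} (hm : 1 ≤ m)
    (hmn : m + 1 ≤ n) (hx : ∀ i, x i = μ + (if m ≤ (i : ℕ) then δ else 0) + ξ i) :
    cusum x m = cusum ξ m - √((m : ℝ) * ((n : ℝ) - m) / n) • δ := by
  have hm0 : (0 : ℝ) < m := by exact_mod_cast hm
  have hnm : (0 : ℝ) < (n : ℝ) - m := by
    have : (m : ℝ) + 1 ≤ n := by exact_mod_cast hmn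
    linarith
  have h1 : leftMean x m = μ + leftMean ξ m := by
    have : ∑ i ∈ Finset.univ.filter (fun i : Fin n => (i : ℕ) < m), x i =
        (m : ℝ) • μ + ∑ i ∈ Finset.univ.filter (fun i : Fin n => (i : ℕ) < m), ξ i := by
      rw [Finset.sum_congr rfl fun i hi => by
        rw [hx i, if_neg (by simpa using hi), add_zero], Finset.sum_add_distrib, Finset.sum_const,
        card_filter_val_lt (by omega), Nat.cast_smul_eq_nsmul]
    rw [leftMean, this, smul_add, smul_smul, one_div_mul_cancel hm0.ne', one_smul, leftMean]
  have h2 : rightMean x m = μ + δ + rightMean ξ m := by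
    have : ∑ i ∈ Finset.univ.filter (fun i : Fin n => m ≤ (i : ℕ)), x i =
        ((n : ℝ) - m) • (μ + δ) +
          ∑ i ∈ Finset.univ.filter (fun i : Fin n => m ≤ (i : ℕ)), ξ i := by
      rw [Finset.sum_congr rfl fun i hi => by
        rw [hx i, if_pos (by simpa using hi)], Finset.sum_add_distrib, Finset.sum_const,
        card_filter_le_val (by omega), ← Nat.cast_sub (by omega), Nat.cast_smul_eq_nsmul]
    rw [rightMean, this, smul_add, smul_smul, one_div_mul_cancel hnm.ne', one_smul, rightMean]
  rw [cusum, h1, h2, cusum, ← smul_sub]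
  congr 1
  abel

theorem norm_cusum_le_cusumStat {n p m : ℕ} {u : ℝ} (x : Fin n → Fin p → ℝ)
    (hm : m ∈ interiorTimes n u) : ‖cusum x m‖ ≤ cusumStat u x :=
  le_ciSup (f := fun s : interiorTimes n u => ‖cusum x s‖) (Set.finite_range _).bddAbove ⟨m, hm⟩

end CusumTest

/-! ### High-probability events and detection of the change. -/

namespace CusumTest

theorem measureReal_biUnion_le_card_mul {Ω ι : Type*} [MeasurableSpace Ω] {P : Measure Ω}
    (F : Finset ι) (S : ι → Set Ω) {r N : ℝ}
    (hr : 0 ≤ r) (hN : (F.card : ℝ) ≤ N) (hS : ∀ q ∈ F, P.real (S q) ≤ r) :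
    P.real (⋃ q ∈ F, S q) ≤ N * r := by
  refine (measureReal_biUnion_finset_le _ _).trans
    ((Finset.sum_le_card_nsmul _ _ r hS).trans ?_)
  rw [nsmul_eq_mul]
  gcongr

section

variable {Ω : Type*} [MeasurableSpace Ω] {P : Measure Ω} [IsProbabilityMeasure P]

/-- Uniform bound for the CUSUM process of the noise at a fixed time, on the event that the noise
is bounded by `L`. -/
theorem measureReal_norm_cusum_le {n p m : ℕ} {ξ : Fin n → Ω → Fin p → ℝ} {u V L b : ℝ}
    (hm : Measurable fun ω i => ξ i ω) (hind : iIndepFun ξ P)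
    (h1 : ∀ i j, Integrable (fun ω => ξ i ω j) P)
    (h2 : ∀ i j, Integrable (fun ω => ξ i ω j ^ 2) P)
    (hmean : ∀ i j, ∫ ω, ξ i ω j ∂P = 0) (hV : ∀ i j, ∫ ω, ξ i ω j ^ 2 ∂P ≤ V)
    (hu : 1 ≤ u) (hum : u ≤ m) (hmu : u ≤ (n : ℝ) - m) (hb : 0 < b) (hL : L ^ 2 * b ≤ u)
    (hV0 : 0 ≤ V) :
    P.real {ω | (∀ i j, |ξ i ω j| ≤ L) ∧ (V + 2) * √b < ‖cusum (fun i => ξ i ω) m‖} ≤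
      2 * p * Real.exp (-(2 * b)) := by
  have hu0 : 0 < u := by linarith
  have hm1 : 1 ≤ m := by exact_mod_cast hu.trans hum
  have hmn : m + 1 ≤ n := by
    have : (m : ℝ) + 1 ≤ n := by linarith
    exact_mod_cast this
  have hsb : √b * √b = b := Real.mul_self_sqrt hb.le
  -- The second index is a sign, to treat both tails; `√b` is the Chernoff parameter. As the squared
  -- CUSUM weights sum to `1`, the exponent is `V b - (V + 2) b = -2b`.
  let S : Fin p × ℝ → Set Ω := fun q => {ω |
    (∀ i, |q.2 * √b * cusumCoeff n m i * ξ i ω q.1| ≤ 1) ∧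
      (V + 2) * b ≤ ∑ i, q.2 * √b * cusumCoeff n m i * ξ i ω q.1}
  have hS : ∀ (j : Fin p) (σ : ℝ), σ ^ 2 = 1 → P.real (S (j, σ)) ≤ Real.exp (-(2 * b)) := by
    intro j σ hσ
    have hmj : ∀ i, Measurable fun ω => ξ i ω j := fun i =>
      (measurable_pi_apply j).comp ((measurable_pi_apply i).comp hm)
    have h := measure_le_weighted_sum (P := P) (ξ := fun i ω => ξ i ω j) hmj
      (hind.comp (fun _ x => x j) fun _ => measurable_pi_apply j) (fun i => h1 i j)
      (fun i => h2 i j) (fun i => hmean i j) (fun i => hV i j)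
      (fun i => σ * √b * cusumCoeff n m i) ((V + 2) * b)
    have hsum : ∑ i, (σ * √b * cusumCoeff n m i) ^ 2 = b := by
      simp only [mul_pow, ← Finset.mul_sum, sum_cusumCoeff_sq hm1 hmn, hσ,
        Real.sq_sqrt hb.le, one_mul, mul_one]
    rw [hsum, show V * b - (V + 2) * b = -(2 * b) by ring] at h
    exact ENNReal.toReal_le_of_le_ofReal (Real.exp_pos _).le h
  have hsub : {ω | (∀ i j, |ξ i ω j| ≤ L) ∧ (V + 2) * √b < ‖cusum (fun i => ξ i ω) m‖} ⊆
      ⋃ q ∈ (Finset.univ : Finset (Fin p)) ×ˢ ({1, -1} : Finset ℝ), S q := by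
    rintro ω ⟨hω, hlt⟩
    have hex : ∃ j, (V + 2) * √b < |cusum (fun i => ξ i ω) m j| := by
      by_contra! hcon
      exact hlt.not_ge ((pi_norm_le_iff_of_nonneg (by positivity)).2 hcon)
    obtain ⟨j, hj⟩ := hex
    have hsmall : ∀ (σ : ℝ), σ ^ 2 = 1 → ∀ i, |σ * √b * cusumCoeff n m i * ξ i ω j| ≤ 1 := by
      intro σ hσ i
      rw [← sq_le_one_iff_abs_le_one, mul_pow, mul_pow, mul_pow, hσ, Real.sq_sqrt hb.le, one_mul]
      have e1 := cusumCoeff_sq_le hu0 hum hmu i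
      have e2 : ξ i ω j ^ 2 ≤ L ^ 2 := sq_le_sq' (abs_le.1 (hω i j)).1 (abs_le.1 (hω i j)).2
      calc b * cusumCoeff n m i ^ 2 * ξ i ω j ^ 2 ≤ b * (1 / u) * L ^ 2 := by gcongr
        _ = L ^ 2 * b / u := by ring
        _ ≤ 1 := (div_le_one hu0).2 hL
    have hbound : ∀ σ : ℝ, (V + 2) * √b ≤ σ * cusum (fun i => ξ i ω) m j →
        (V + 2) * b ≤ ∑ i, σ * √b * cusumCoeff n m i * ξ i ω j := by
      intro σ h
      have e : ∑ i, σ * √b * cusumCoeff n m i * ξ i ω j =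
          √b * (σ * cusum (fun i => ξ i ω) m j) := by
        rw [cusum_apply, Finset.mul_sum, Finset.mul_sum]
        exact Finset.sum_congr rfl fun i _ => by ring
      rw [e]
      calc (V + 2) * b = √b * ((V + 2) * √b) := by rw [mul_left_comm, hsb]
        _ ≤ _ := by gcongr
    rcases lt_abs.1 hj with h | h
    · exact Set.mem_iUnion₂.2 ⟨(j, 1), by simp, hsmall 1 (by norm_num),
        hbound 1 (by linarith)⟩
    · exact Set.mem_iUnion₂.2 ⟨(j, -1), by simp, hsmall (-1) (by norm_num),
        hbound (-1) (by linarith)⟩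
  refine (measureReal_mono hsub (measure_ne_top _ _)).trans
    (measureReal_biUnion_le_card_mul _ _ (Real.exp_pos _).le ?_ ?_)
  · rw [Finset.card_product, Finset.card_univ, Fintype.card_fin]
    have : (({1, -1} : Finset ℝ).card : ℝ) ≤ 2 := by exact_mod_cast Finset.card_le_two
    push_cast
    have hp0 : (0 : ℝ) ≤ p := by positivity
    nlinarith
  · rintro ⟨j, σ⟩ hq
    have hσ : σ = 1 ∨ σ = -1 := by simpa using hq
    exact hS j σ (by rcases hσ with rfl | rfl <;> norm_num)

/-- Tail of a partial sum of squares on the event that the noise is bounded by `L`. -/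
theorem measureReal_sum_sq_le {n p : ℕ} {ξ : Fin n → Ω → Fin p → ℝ} {V L k : ℝ}
    (hm : Measurable fun ω i => ξ i ω) (hind : iIndepFun ξ P)
    (h2 : ∀ i j, Integrable (fun ω => ξ i ω j ^ 2) P)
    (hV : ∀ i j, ∫ ω, ξ i ω j ^ 2 ∂P ≤ V) (hL : 0 < L) (T : Finset (Fin n))
    (hT : (T.card : ℝ) = k) (j : Fin p) :
    P.real {ω | (∀ i j, |ξ i ω j| ≤ L) ∧ k * (2 * V + 1) < ∑ i ∈ T, ξ i ω j ^ 2} ≤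
      Real.exp (-(k / L ^ 2)) := by
  have hmj : ∀ i, Measurable fun ω => ξ i ω j := fun i =>
    (measurable_pi_apply j).comp ((measurable_pi_apply i).comp hm)
  have h := measure_le_weighted_sum_sq (P := P) (ξ := fun i ω => ξ i ω j) hmj
    (hind.comp (fun _ x => x j) fun _ => measurable_pi_apply j)
    -- Scaling by `1/L²` makes each summand at most `1` on the event of bounded noise.
    (fun i => h2 i j) (fun i => hV i j) (fun i => if i ∈ T then 1 / L ^ 2 else 0)
    (fun i => by split_ifs <;> positivity) (k * (2 * V + 1) / L ^ 2)
  have hsum : ∑ i, (if i ∈ T then 1 / L ^ 2 else 0) = k / L ^ 2 := by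
    rw [Finset.sum_ite_mem, Finset.univ_inter, Finset.sum_const, nsmul_eq_mul, hT]
    ring
  rw [hsum, show 2 * V * (k / L ^ 2) - k * (2 * V + 1) / L ^ 2 = -(k / L ^ 2) by ring] at h
  refine (measureReal_mono (fun ω hω => ?_) (measure_ne_top _ _)).trans
    (ENNReal.toReal_le_of_le_ofReal (Real.exp_pos _).le h)
  obtain ⟨hω, hlt⟩ := hω
  refine ⟨fun i => ?_, ?_⟩
  · have e2 : ξ i ω j ^ 2 ≤ L ^ 2 := sq_le_sq' (abs_le.1 (hω i j)).1 (abs_le.1 (hω i j)).2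
    split_ifs
    · rw [abs_of_nonneg (by positivity), one_div_mul_eq_div]
      exact (div_le_one (by positivity)).2 e2
    · simp
  · simp only [ite_mul, zero_mul, Finset.sum_ite_mem, Finset.univ_inter, ← Finset.mul_sum]
    rw [one_div_mul_eq_div]
    gcongr

/-- All partial sums of squares are controlled uniformly over times and coordinates. -/
theorem measureReal_exists_sum_sq_le {n p : ℕ} {ξ : Fin n → Ω → Fin p → ℝ} {u V L b : ℝ}
    (hm : Measurable fun ω i => ξ i ω) (hind : iIndepFun ξ P)
    (h2 : ∀ i j, Integrable (fun ω => ξ i ω j ^ 2) P)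
    (hV : ∀ i j, ∫ ω, ξ i ω j ^ 2 ∂P ≤ V) (hL : 0 < L) (hu : 1 ≤ u)
    (hLu : 3 * L ^ 2 * b ≤ u) :
    P.real {ω | (∀ i j, |ξ i ω j| ≤ L) ∧ ∃ s ∈ interiorTimes n u, ∃ j,
      (s : ℝ) * (2 * V + 1) <
          ∑ i ∈ Finset.univ.filter (fun i : Fin n => (i : ℕ) < s), ξ i ω j ^ 2 ∨
        ((n : ℝ) - s) * (2 * V + 1) <
          ∑ i ∈ Finset.univ.filter (fun i : Fin n => s ≤ (i : ℕ)), ξ i ω j ^ 2} ≤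
      n * p * (2 * Real.exp (-(3 * b))) := by
  let S : ℕ × Fin p → Set Ω := fun q =>
    {ω | (∀ i j, |ξ i ω j| ≤ L) ∧ (q.1 : ℝ) * (2 * V + 1) <
      ∑ i ∈ Finset.univ.filter (fun i : Fin n => (i : ℕ) < q.1), ξ i ω q.2 ^ 2} ∪
    {ω | (∀ i j, |ξ i ω j| ≤ L) ∧ ((n : ℝ) - q.1) * (2 * V + 1) <
      ∑ i ∈ Finset.univ.filter (fun i : Fin n => q.1 ≤ (i : ℕ)), ξ i ω q.2 ^ 2}
  refine (measureReal_mono (s₂ := ⋃ q ∈ interiorTimes n u ×ˢ (Finset.univ : Finset (Fin p)), S q)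
    ?_ (measure_ne_top _ _)).trans (measureReal_biUnion_le_card_mul _ _ (by positivity) ?_ ?_)
  · rintro ω ⟨hω, s, hs, j, h⟩
    exact Set.mem_iUnion₂.2 ⟨(s, j), by simpa using hs, h.imp (fun h => ⟨hω, h⟩) fun h => ⟨hω, h⟩⟩
  · rw [Finset.card_product, Finset.card_univ, Fintype.card_fin]
    have hc : ((interiorTimes n u).card : ℝ) ≤ n := by exact_mod_cast card_interiorTimes_le hu
    push_cast
    gcongr
  · rintro ⟨s, j⟩ hq
    obtain ⟨hs1, hsn, hus, hun⟩ := mem_interiorTimes hu (Finset.mem_product.1 hq).1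
    have hexp : ∀ k : ℝ, u ≤ k → Real.exp (-(k / L ^ 2)) ≤ Real.exp (-(3 * b)) := by
      intro k hk
      apply Real.exp_le_exp.2
      have : 3 * b ≤ k / L ^ 2 := by
        rw [le_div_iff₀ (by positivity)]
        linarith
      linarith
    refine (measureReal_union_le _ _).trans ?_
    have e1 := (measureReal_sum_sq_le (P := P) hm hind h2 hV hL
      (Finset.univ.filter fun i : Fin n => (i : ℕ) < s)
      (congrArg (Nat.cast (R := ℝ)) (card_filter_val_lt (by omega))) j).trans (hexp _ hus)
    have e2 := (measureReal_sum_sq_le (P := P) hm hind h2 hV hL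
      (Finset.univ.filter fun i : Fin n => s ≤ (i : ℕ)) (k := (n : ℝ) - s)
      (by rw [card_filter_le_val (by omega), Nat.cast_sub (by omega)]) j).trans (hexp _ hun)
    linarith

end

/-- The signal condition in terms of the drift of the CUSUM statistic at the change point. -/
theorem mul_sqrt_le_of_signal {n p m : ℕ} {ζ α C d : ℝ} (hC : 0 ≤ C) (hm : 1 ≤ m)
    (hmn : m + 1 ≤ n) (hζ : 0 < ζ) (hζ1 : ζ < 1) (hb : 0 ≤ Real.log ((n : ℝ) * p))
    (h : C * signalThreshold n p m ζ α ≤ d) :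
    C * √(Real.log ((n : ℝ) * p / α)) ≤ √((m : ℝ) * ((n : ℝ) - m) / n) * d := by
  have hm0 : (0 : ℝ) < m := by exact_mod_cast hm
  have hnm : (0 : ℝ) < (n : ℝ) - m := by
    have : (m : ℝ) + 1 ≤ n := by exact_mod_cast hmn
    linarith
  have hn : (0 : ℝ) < n := by linarith
  have hR : (n : ℝ) * ((m : ℝ) / n) * (1 - (m : ℝ) / n) = (m : ℝ) * ((n : ℝ) - m) / n := by
    field_simp
  have hpos : (0 : ℝ) < (m : ℝ) * ((n : ℝ) - m) / n := by positivity
  have hz : 0 ≤ Real.log ζ⁻¹ := Real.log_nonneg ((one_le_inv₀ hζ).2 hζ1.le)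
  rw [signalThreshold, hR] at h
  set R := (m : ℝ) * ((n : ℝ) - m) / n
  refine le_trans ?_ (mul_le_mul_of_nonneg_left h (Real.sqrt_nonneg R))
  -- `R = n t_m (1 - t_m)` is the squared drift factor, so it cancels the denominator of the
  -- threshold; the nonnegative term `log(1/ζ) log(np)` is then dropped.
  rw [mul_left_comm, ← Real.sqrt_mul hpos.le, mul_div_cancel₀ _ hpos.ne']
  gcongr
  nlinarith [mul_nonneg hz hb]

/-- If the noise is bounded by `L` with probability at least `1 - ρ`, where
`3 L² log(np) ≤ u`, the bootstrap test detects the change. -/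
theorem le_measureReal_rejectionEvent {Ω : Type*} [MeasurableSpace Ω] {P : Measure Ω}
    [IsProbabilityMeasure P] {n p m : ℕ} {u ζ α V L ρ : ℝ} {μ δ : Fin p → ℝ}
    {X ξ : Fin n → Ω → Fin p → ℝ} {e : Fin n → Ω → ℝ} (hn : 4 ≤ n) (hp : 3 ≤ p) (hu : 1 ≤ u)
    (hX : MeanShiftModel P X ξ μ δ m) (he : GaussianMultipliers P e X) (hum : u ≤ m)
    (hmu : (m : ℝ) ≤ n - u) (h2 : ∀ i j, Integrable (fun ω => ξ i ω j ^ 2) P)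
    (hV : ∀ i j, ∫ ω, ξ i ω j ^ 2 ∂P ≤ V) (hV0 : 0 ≤ V) (hL : 0 < L)
    (hLu : 3 * L ^ 2 * Real.log ((n : ℝ) * p) ≤ u)
    (hρ : P.real {ω | ∃ i j, L < |ξ i ω j|} ≤ ρ) (hζ : 0 < ζ) (hζ1 : ζ < 1) (hα : 0 < α)
    (hα1 : α < 1) (hδ : ‖δ‖ ≤ 1)
    (hsig : (V + 3 + 2 * √(4 * V + 4)) * signalThreshold n p m ζ α ≤ ‖δ‖) :
    1 - ρ - 2 / (n * p) ≤ P.real (rejectionEvent P u α X e) := by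
  have hn' : (4 : ℝ) ≤ n := by exact_mod_cast hn
  have hp' : (3 : ℝ) ≤ p := by exact_mod_cast hp
  have hnp : (12 : ℝ) ≤ (n : ℝ) * p := by nlinarith
  set b := Real.log ((n : ℝ) * p) with hb
  have hb0 : 0 < b := Real.log_pos (by linarith)
  have hexpb : Real.exp (-b) = 1 / ((n : ℝ) * p) := by
    rw [Real.exp_neg, hb, Real.exp_log (by linarith), one_div]
  have hm1 : 1 ≤ m := by exact_mod_cast hu.trans hum
  have hmn : m + 1 ≤ n := by
    have : (m : ℝ) + 1 ≤ n := by linarith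
    exact_mod_cast this
  have hXm : ∀ i, Measurable (X i) := fun i => by
    have : X i = fun ω => (μ + if m ≤ (i : ℕ) then δ else 0) + ξ i ω := funext (hX.obs_eq i)
    rw [this]
    exact (hX.measurable_noise i).const_add _
  have hξm : Measurable fun ω i => ξ i ω := measurable_pi_lambda _ hX.measurable_noise
  set A : ℝ := 4 * V + 4 with hA
  have hA0 : 0 < A := by positivity
  set B0 : Set Ω := {ω | ∃ i j, L < |ξ i ω j|}
  set B1 : Set Ω := {ω | (∀ i j, |ξ i ω j| ≤ L) ∧ (V + 2) * √b < ‖cusum (fun i => ξ i ω) m‖}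
  set B2 : Set Ω := {ω | (∀ i j, |ξ i ω j| ≤ L) ∧ ∃ s ∈ interiorTimes n u, ∃ j,
      (s : ℝ) * (2 * V + 1) <
          ∑ i ∈ Finset.univ.filter (fun i : Fin n => (i : ℕ) < s), ξ i ω j ^ 2 ∨
        ((n : ℝ) - s) * (2 * V + 1) <
          ∑ i ∈ Finset.univ.filter (fun i : Fin n => s ≤ (i : ℕ)), ξ i ω j ^ 2}
  -- The exceptional null set of the quantile bound. Only outer measure and subadditivity are used,
  -- so none of these events need be measurable.
  set B3 : Set Ω := {ω |
    (∀ s ∈ interiorTimes n u, ∀ j, ∑ i, bootCoeff (fun i => X i ω) s j i ^ 2 ≤ A) →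
      condQuantile P (fun ω' => bootStat u (fun i => X i ω') (fun i => e i ω'))
        (fun ω' i => X i ω') (1 - α) ω ≤ √(2 * A * Real.log (2 * n * p / α))}ᶜ with hB3
  have p1 : P.real B1 ≤ 1 / (n * p) := by
    have h := measureReal_norm_cusum_le (P := P) (m := m) (u := u) (L := L) (b := b) hξm
      hX.indep_noise hX.integrable_noise h2 hX.mean_noise hV hu hum (by linarith) hb0
      (by nlinarith [mul_nonneg (sq_nonneg L) hb0.le]) hV0
    refine h.trans ?_
    rw [show -(2 * b) = -b + -b by ring, Real.exp_add, hexpb]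
    have : 2 * (p : ℝ) * (1 / (n * p) * (1 / (n * p))) = 2 / n * (1 / (n * p)) := by field_simp
    rw [this]
    have h2n : 2 / (n : ℝ) ≤ 1 := (div_le_one (by linarith)).2 (by linarith)
    exact mul_le_of_le_one_left (by positivity) h2n
  have p2 : P.real B2 ≤ 1 / (n * p) := by
    have h := measureReal_exists_sum_sq_le (P := P) (u := u) (L := L) (b := b) hξm
      hX.indep_noise h2 hV hL hu hLu
    refine h.trans ?_
    rw [show -(3 * b) = -b + -b + -b by ring, Real.exp_add, Real.exp_add, hexpb]
    have : (n : ℝ) * p * (2 * (1 / (n * p) * (1 / (n * p)) * (1 / (n * p)))) =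
        2 / (n * p) * (1 / (n * p)) := by field_simp
    rw [this]
    have h2n : 2 / ((n : ℝ) * p) ≤ 1 := (div_le_one (by linarith)).2 (by linarith)
    exact mul_le_of_le_one_left (by positivity) h2n
  have p3 : P.real B3 = 0 := by
    have h := ae_condQuantile_le hXm he hu hα hα1 hA0 (by omega) (by omega)
    rw [measureReal_def, hB3, show P _ = 0 from h, ENNReal.toReal_zero]
  have hcover : Set.univ ⊆ rejectionEvent P u α X e ∪ (B0 ∪ (B1 ∪ (B2 ∪ B3))) := by
    intro ω _
    by_contra hω
    simp only [Set.mem_union, not_or] at hω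
    obtain ⟨hr, w0, w1, w2, w3⟩ := hω
    apply hr
    have g0 : ∀ i j, |ξ i ω j| ≤ L := fun i j => not_lt.1 fun h => w0 ⟨i, j, h⟩
    have g1 : ‖cusum (fun i => ξ i ω) m‖ ≤ (V + 2) * √b := not_lt.1 fun h => w1 ⟨g0, h⟩
    have g2 : ∀ s ∈ interiorTimes n u, ∀ j, ∑ i, bootCoeff (fun i => X i ω) s j i ^ 2 ≤ A := by
      intro s hs j
      obtain ⟨hs1, hsn, -, -⟩ := mem_interiorTimes hu hs
      -- The unremoved shift costs at most `|δ j| ≤ 1`. Averaging gives `2 + 2(2V + 1) = 4V + 4 =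
      -- A`.
      have hterm : ∀ i, (X i ω j - μ j) ^ 2 ≤ 2 + 2 * ξ i ω j ^ 2 := by
        intro i
        have hd : |δ j| ≤ 1 := (norm_le_pi_norm δ j).trans hδ
        have hd2 : δ j ^ 2 ≤ 1 := (sq_le_one_iff_abs_le_one _).2 hd
        rw [hX.obs_eq i ω]
        split_ifs
        · simp only [Pi.add_apply]
          nlinarith [sq_nonneg (δ j - ξ i ω j)]
        · simp only [Pi.add_apply, Pi.zero_apply]
          nlinarith [sq_nonneg (ξ i ω j)]
      have hbound : ∀ (T : Finset (Fin n)) (k : ℝ), (T.card : ℝ) = k →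
          ∑ i ∈ T, ξ i ω j ^ 2 ≤ k * (2 * V + 1) → ∑ i ∈ T, (X i ω j - μ j) ^ 2 ≤ k * A := by
        intro T k hk h
        refine (Finset.sum_le_sum fun i _ => hterm i).trans ?_
        rw [Finset.sum_add_distrib, Finset.sum_const, nsmul_eq_mul, hk, ← Finset.mul_sum, hA]
        linarith
      refine sum_bootCoeff_sq_le (fun i => X i ω) hs1 hsn j (c := μ j)
        (hbound _ _ (congrArg (Nat.cast (R := ℝ)) (card_filter_val_lt (by omega))) ?_)
        (hbound _ _ (by rw [card_filter_le_val (by omega), Nat.cast_sub (by omega)]) ?_)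
      · exact not_lt.1 fun h => w2 ⟨g0, s, hs, j, Or.inl h⟩
      · exact not_lt.1 fun h => w2 ⟨g0, s, hs, j, Or.inr h⟩
    have g3 := (not_not.1 w3) g2
    refine lt_of_le_of_lt g3 ?_
    have hmem : m ∈ interiorTimes n u := by
      simp only [interiorTimes, Finset.mem_filter, Finset.mem_range]
      exact ⟨by omega, hum, hmu⟩
    refine lt_of_lt_of_le ?_ (norm_cusum_le_cusumStat (fun i => X i ω) hmem)
    rw [cusum_eq_of_shift hm1 hmn fun i => hX.obs_eq i ω]
    set R := √((m : ℝ) * ((n : ℝ) - m) / n)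
    set g := Real.log ((n : ℝ) * p / α)
    have hsig' := mul_sqrt_le_of_signal (by positivity) hm1 hmn hζ hζ1 hb0.le hsig
    have hbg : b ≤ g := by
      apply Real.log_le_log (by linarith)
      rw [le_div_iff₀ hα]
      nlinarith
    have hlog2 : Real.log (2 * n * p / α) ≤ 2 * g := by
      have e1 : Real.log (2 * n * p / α) = Real.log 2 + g := by
        rw [← Real.log_mul (by norm_num) (by positivity)]
        congr 1
        ring
      have e2 : Real.log 2 ≤ b := Real.log_le_log (by norm_num) (by linarith)
      linarith
    have ht : √(2 * A * Real.log (2 * n * p / α)) ≤ 2 * √A * √g := by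
      apply Real.sqrt_le_iff.2 ⟨by positivity, ?_⟩
      rw [mul_pow, mul_pow, Real.sq_sqrt hA0.le, Real.sq_sqrt (by linarith)]
      nlinarith
    have hbg' : √b ≤ √g := Real.sqrt_le_sqrt hbg
    have hg0 : 0 < √g := Real.sqrt_pos.2 (by linarith)
    have hnorm : R * ‖δ‖ - ‖cusum (fun i => ξ i ω) m‖ ≤ ‖cusum (fun i => ξ i ω) m - R • δ‖ := by
      have h := norm_sub_norm_le (R • δ) (cusum (fun i => ξ i ω) m)
      rw [norm_smul, Real.norm_of_nonneg (Real.sqrt_nonneg _), norm_sub_rev] at h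
      exact h
    have hVb : (V + 2) * √b ≤ (V + 2) * √g := by gcongr
    -- The signal constant pays for the noise, `V + 2`, and the quantile, `2√A`; the remaining `√g >
    -- 0` makes the inequality strict.
    have hring : (V + 3 + 2 * √A) * √g = (V + 2) * √g + √g + 2 * √A * √g := by ring
    linarith
  have hone := measureReal_mono (μ := P) hcover (measure_ne_top _ _)
  rw [probReal_univ] at hone
  have u1 := measureReal_union_le (μ := P) (rejectionEvent P u α X e) (B0 ∪ (B1 ∪ (B2 ∪ B3)))
  have u2 := measureReal_union_le (μ := P) B0 (B1 ∪ (B2 ∪ B3))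
  have u3 := measureReal_union_le (μ := P) B1 (B2 ∪ B3)
  have u4 := measureReal_union_le (μ := P) B2 B3
  have : 2 / ((n : ℝ) * p) = 1 / (n * p) + 1 / (n * p) := by ring
  linarith

end CusumTest

/-! ### Moment bounds and envelopes for the noise. -/

namespace CusumTest

theorem measureReal_lt_abs_le_of_psiNorm {Ω : Type*} [MeasurableSpace Ω] {P : Measure Ω} {Y : Ω → ℝ}
    (hY : Measurable Y) {bu b : ℝ}
    (hbu : 0 < bu) (hb : 1 ≤ b) (h : psiNorm P 1 Y ≤ ENNReal.ofReal bu) :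
    P.real {ω | 6 * bu * b < |Y ω|} ≤ 2 * Real.exp (-(3 * b)) := by
  -- Doubling `bu` yields an admissible `C < 2 bu` without attaining the infimum. Then `|Y| > 6 bu
  -- b` forces `|Y|/C ≥ 3b`.
  have hlt : psiNorm P 1 Y < ENNReal.ofReal (2 * bu) :=
    h.trans_lt ((ENNReal.ofReal_lt_ofReal_iff (by linarith)).2 (by linarith))
  simp only [psiNorm, iInf_lt_iff] at hlt
  obtain ⟨C, hC, hle, hCb⟩ := hlt
  have hCb' : C < 2 * bu := (ENNReal.ofReal_lt_ofReal_iff (by linarith)).1 hCb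
  have hexp : 2 ≤ Real.exp (3 * b) := by linarith [Real.add_one_le_exp (3 * b)]
  have hpos : 0 < Real.exp (3 * b) - 1 := by linarith
  have hmark := meas_ge_le_lintegral_div (μ := P)
    (f := fun ω => ENNReal.ofReal (Real.exp ((|Y ω| / C) ^ (1 : ℝ)) - 1))
    (by fun_prop) (ε := ENNReal.ofReal (Real.exp (3 * b) - 1))
    (by simpa using hpos) ENNReal.ofReal_ne_top
  have hmain : P {ω | 6 * bu * b < |Y ω|} ≤ ENNReal.ofReal (2 * Real.exp (-(3 * b))) := by
    refine (measure_mono fun ω hω => ?_).trans (hmark.trans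
      ((ENNReal.div_le_div_right hle _).trans ?_))
    · have hω' : 6 * bu * b < |Y ω| := hω
      apply ENNReal.ofReal_le_ofReal
      rw [Real.rpow_one]
      have : 3 * b ≤ |Y ω| / C := by
        rw [le_div_iff₀ hC]
        nlinarith
      have := Real.exp_le_exp.2 this
      linarith
    · rw [← ENNReal.ofReal_one, ← ENNReal.ofReal_div_of_pos hpos]
      apply ENNReal.ofReal_le_ofReal
      rw [Real.exp_neg, ← div_eq_mul_inv, div_le_div_iff₀ hpos (Real.exp_pos _)]
      linarith
  exact ENNReal.toReal_le_of_le_ofReal (by positivity) hmain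

section

variable {Ω : Type*} [MeasurableSpace Ω] {P : Measure Ω} [IsProbabilityMeasure P]

/-- From `t² ≤ 1 + |t|³`; this supplies `V = 1 + bu`. -/
theorem CondB.integrable_sq_and_integral_le {n p : ℕ} {ξ : Fin n → Ω → Fin p → ℝ} {bu : ℝ}
    (hm : ∀ i, Measurable (ξ i)) (hB : CondB P ξ bu) (i : Fin n) (j : Fin p) :
    Integrable (fun ω => ξ i ω j ^ 2) P ∧ ∫ ω, ξ i ω j ^ 2 ∂P ≤ 1 + bu := by
  obtain ⟨hI, hle⟩ := hB 1 (Or.inl rfl) i j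
  have hmj : Measurable fun ω => ξ i ω j := (measurable_pi_apply j).comp (hm i)
  have hpt : ∀ ω, ξ i ω j ^ 2 ≤ 1 + |ξ i ω j| ^ (2 + 1) := by
    intro ω
    rw [← sq_abs]
    have := abs_nonneg (ξ i ω j)
    rcases le_total |ξ i ω j| 1 with h | h
    · have := pow_le_one₀ (n := 2) this h
      have := pow_nonneg (abs_nonneg (ξ i ω j)) (2 + 1)
      linarith
    · have := pow_le_pow_right₀ h (show 2 ≤ 2 + 1 by norm_num)
      linarith
  have hI' : Integrable (fun ω => 1 + |ξ i ω j| ^ (2 + 1)) P := (integrable_const _).add hI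
  have h2 : Integrable (fun ω => ξ i ω j ^ 2) P := by
    refine hI'.mono' (hmj.pow_const 2).aestronglyMeasurable (ae_of_all _ fun ω => ?_)
    rw [Real.norm_of_nonneg (sq_nonneg _)]
    exact hpt ω
  refine ⟨h2, (integral_mono h2 hI' hpt).trans ?_⟩
  rw [integral_add (integrable_const _) hI]
  simpa using hle

theorem CondC.measureReal_exists_lt_abs_le {n p : ℕ} {ξ : Fin n → Ω → Fin p → ℝ} {bu b : ℝ}
    (hm : ∀ i, Measurable (ξ i)) (hbu : 0 < bu) (hb : 1 ≤ b) (hC : CondC P ξ bu) :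
    P.real {ω | ∃ i j, 6 * bu * b < |ξ i ω j|} ≤ n * p * (2 * Real.exp (-(3 * b))) := by
  have hset : {ω | ∃ i j, 6 * bu * b < |ξ i ω j|} ⊆
      ⋃ q ∈ (Finset.univ : Finset (Fin n × Fin p)), {ω | 6 * bu * b < |ξ q.1 ω q.2|} := by
    rintro ω ⟨i, j, h⟩
    exact Set.mem_iUnion₂.2 ⟨(i, j), Finset.mem_univ _, h⟩
  refine (measureReal_mono hset (measure_ne_top _ _)).trans
    (measureReal_biUnion_le_card_mul _ _ (by positivity) (by simp) fun q _ => ?_)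
  exact measureReal_lt_abs_le_of_psiNorm ((measurable_pi_apply q.2).comp (hm q.1)) hbu hb
    (hC q.1 q.2)

/-- Markov's inequality at level `n/γ` for the coordinatewise maximum, followed by a union over the
`n` times only, so that `p` does not enter. -/
theorem CondD.measureReal_exists_lt_abs_le {n p : ℕ} {ξ : Fin n → Ω → Fin p → ℝ} {bu q γ : ℝ}
    (hm : ∀ i, Measurable (ξ i)) (hbu : 0 < bu) (hq : 0 < q) (hγ : 0 < γ) (hn : 0 < n)
    (hD : CondD P ξ bu q) :
    P.real {ω | ∃ i j, bu * ((n : ℝ) / γ) ^ (1 / q) < |ξ i ω j|} ≤ γ := by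
  have hn0 : (0 : ℝ) < n := by exact_mod_cast hn
  have hone : ∀ i : Fin n, P.real {ω | ∃ j, bu * ((n : ℝ) / γ) ^ (1 / q) < |ξ i ω j|} ≤ γ / n := by
    intro i
    have hmark := meas_ge_le_lintegral_div (μ := P)
      (f := fun ω => ⨆ j, ENNReal.ofReal ((|ξ i ω j| / bu) ^ q))
      (Measurable.iSup fun j => by
        have : Measurable fun ω => ξ i ω j := (measurable_pi_apply j).comp (hm i)
        fun_prop).aemeasurable (ε := ENNReal.ofReal (n / γ))
      (by simpa using div_pos hn0 hγ) ENNReal.ofReal_ne_top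
    refine ENNReal.toReal_le_of_le_ofReal (by positivity) ((measure_mono fun ω hω => ?_).trans
      (hmark.trans ((ENNReal.div_le_div_right (hD i) _).trans (le_of_eq ?_))))
    · obtain ⟨j, hj⟩ : ∃ j, bu * ((n : ℝ) / γ) ^ (1 / q) < |ξ i ω j| := hω
      refine le_trans (ENNReal.ofReal_le_ofReal ?_)
        (le_iSup (fun j => ENNReal.ofReal ((|ξ i ω j| / bu) ^ q)) j)
      have h1 : ((n : ℝ) / γ) ^ (1 / q) ≤ |ξ i ω j| / bu := by
        rw [le_div_iff₀ hbu, mul_comm]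
        exact hj.le
      have h2 := Real.rpow_le_rpow (by positivity) h1 hq.le
      rwa [← Real.rpow_mul (by positivity), one_div_mul_cancel hq.ne', Real.rpow_one] at h2
    · rw [← ENNReal.ofReal_one, ← ENNReal.ofReal_div_of_pos (by positivity), one_div_div]
  have hset : {ω | ∃ i j, bu * ((n : ℝ) / γ) ^ (1 / q) < |ξ i ω j|} ⊆
      ⋃ i ∈ (Finset.univ : Finset (Fin n)),
        {ω | ∃ j, bu * ((n : ℝ) / γ) ^ (1 / q) < |ξ i ω j|} := by
    rintro ω ⟨i, h⟩
    exact Set.mem_iUnion₂.2 ⟨i, Finset.mem_univ _, h⟩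
  refine (measureReal_mono hset (measure_ne_top _ _)).trans
    ((measureReal_biUnion_le_card_mul (N := n) _ _ (by positivity) (by simp)
      fun i _ => hone i).trans (le_of_eq ?_))
  field_simp

end

/-! ### From small rates to lower bounds on the boundary parameter. -/

theorem sq_mul_le_one_of_mul_rpow_le_one {C x : ℝ} {k : ℕ} (hC : 1 ≤ C) (hx : 0 ≤ x) (hk : 2 ≤ k)
    (h : C * x ^ (1 / (k : ℝ)) ≤ 1) : C ^ 2 * x ≤ 1 := by
  -- The `k`-th power gives `C^k x ≤ 1`; `C²` suffices and serves both `k = 6` and `k = 3`.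
  have h1 : (C * x ^ (1 / (k : ℝ))) ^ k ≤ 1 := pow_le_one₀ (by positivity) h
  rw [mul_pow, one_div, Real.rpow_inv_natCast_pow hx (by omega)] at h1
  refine le_trans ?_ h1
  gcongr

theorem one_le_log_mul {n p : ℕ} (hn : 4 ≤ n) (hp : 3 ≤ p) : 1 ≤ Real.log ((n : ℝ) * p) := by
  have hn' : (4 : ℝ) ≤ n := by exact_mod_cast hn
  have hp' : (3 : ℝ) ≤ p := by exact_mod_cast hp
  rw [Real.le_log_iff_exp_le (by nlinarith)]
  have := Real.exp_one_lt_d9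
  nlinarith

/-- Lets `ϖ_{1,n}` absorb the exceptional probabilities `1/(np)`: since `u ≤ n` and `log(np) ≥ 1`,
the rate is at least `(1/n)^(1/6)`. -/
theorem one_div_le_rateOne {n p : ℕ} {u : ℝ} (hn : 4 ≤ n) (hp : 3 ≤ p) (hu : 0 < u)
    (hun : u ≤ n) : 1 / ((n : ℝ) * p) ≤ rateOne n p u := by
  have hn' : (4 : ℝ) ≤ n := by exact_mod_cast hn
  have hp' : (3 : ℝ) ≤ p := by exact_mod_cast hp
  have hb := one_le_log_mul hn hp
  calc 1 / ((n : ℝ) * p) ≤ 1 / n := by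
        apply one_div_le_one_div_of_le (by linarith)
        nlinarith
    _ = (1 / (n : ℝ)) ^ (1 : ℝ) := (Real.rpow_one _).symm
    _ ≤ (1 / (n : ℝ)) ^ (1 / 6 : ℝ) :=
        Real.rpow_le_rpow_of_exponent_ge (by positivity)
          ((div_le_one (by linarith)).2 (by linarith)) (by norm_num)
    _ ≤ rateOne n p u := by
        apply Real.rpow_le_rpow (by positivity) _ (by norm_num)
        rw [div_le_div_iff₀ (by linarith) hu]
        have : (1 : ℝ) ≤ Real.log ((n : ℝ) * p) ^ 7 := one_le_pow₀ hb
        nlinarith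

theorem le_of_mul_rateOne_le_one {n p : ℕ} {u C : ℝ} (hn : 4 ≤ n) (hp : 3 ≤ p) (hu : 0 < u)
    (hC : 1 ≤ C) (h : C * rateOne n p u ≤ 1) :
    C ^ 2 * Real.log ((n : ℝ) * p) ^ 7 ≤ u := by
  have hb := one_le_log_mul hn hp
  have := sq_mul_le_one_of_mul_rpow_le_one (k := 6) hC (x := Real.log ((n : ℝ) * p) ^ 7 / u)
    (by positivity) (by norm_num) (by push_cast; exact h)
  rwa [← mul_div_assoc, div_le_one hu] at this

theorem le_of_mul_rateTwo_le_one {n p : ℕ} {u γ q C : ℝ} (hn : 4 ≤ n) (hp : 3 ≤ p) (hu : 0 < u)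
    (hγ : 0 < γ) (hC : 1 ≤ C) (h : C * rateTwo n p u γ q ≤ 1) :
    C ^ 2 * (((n : ℝ) / γ) ^ (2 / q) * Real.log ((n : ℝ) * p) ^ 3) ≤ u := by
  have hb := one_le_log_mul hn hp
  have := sq_mul_le_one_of_mul_rpow_le_one (k := 3) hC
    (x := (n : ℝ) ^ (2 / q) * Real.log ((n : ℝ) * p) ^ 3 / (γ ^ (2 / q) * u))
    (by positivity) (by norm_num) (by push_cast; exact h)
  rw [← div_div, ← mul_div_assoc, div_le_one hu] at this
  rwa [Real.div_rpow (by positivity) hγ.le, div_mul_eq_mul_div]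

end CusumTest

/-! ### Choice of constants and conclusion. -/

theorem mainTheorem3 (bl bu K : ℝ) (hbl : 0 < bl) (hbu : 0 < bu) (hK : 0 < K) :
    -- Part (i): sub-exponential noise.
    (∃ C₁ : ℝ, 0 < C₁ ∧ ∃ C₂ : ℝ, 0 < C₂ ∧
      ∀ (Ω : Type*) [MeasurableSpace Ω] (P : Measure Ω) [IsProbabilityMeasure P]
        (n p m : ℕ) (u ζ γ α : ℝ) (μ δ : Fin p → ℝ)
        (X ξ : Fin n → Ω → Fin p → ℝ) (e : Fin n → Ω → ℝ),
        4 ≤ n → 3 ≤ p → 1 ≤ u → u ≤ (n : ℝ) / 2 →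
        CusumTest.MeanShiftModel P X ξ μ δ m →
        CusumTest.GaussianMultipliers P e X →
        CusumTest.Alternative n δ m →
        u ≤ (m : ℝ) → (m : ℝ) ≤ (n : ℝ) - u →
        CusumTest.CondA P ξ bl → CusumTest.CondB P ξ bu → CusumTest.CondC P ξ bu →
        ζ ∈ Set.Ioo (0 : ℝ) (1 / 2) → γ ∈ Set.Ioo (0 : ℝ) (Real.exp (-1)) →
        Real.log γ⁻¹ ≤ K * Real.log ((p : ℝ) * n) →
        α ∈ Set.Ioo (0 : ℝ) 1 →
        ‖δ‖ ≤ 1 →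
        C₁ * CusumTest.signalThreshold n p m ζ α ≤ ‖δ‖ →
        1 - γ - C₂ * CusumTest.rateOne n p u - 2 * ζ ≤
          P.real (CusumTest.rejectionEvent P u α X e)) ∧
    -- Part (ii): noise with polynomial moments.
    (∀ q : ℝ, 0 < q → ∃ C₁ : ℝ, 0 < C₁ ∧ ∃ C₂ : ℝ, 0 < C₂ ∧
      ∀ (Ω : Type*) [MeasurableSpace Ω] (P : Measure Ω) [IsProbabilityMeasure P]
        (n p m : ℕ) (u ζ γ α : ℝ) (μ δ : Fin p → ℝ)
        (X ξ : Fin n → Ω → Fin p → ℝ) (e : Fin n → Ω → ℝ),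
        4 ≤ n → 3 ≤ p → 1 ≤ u → u ≤ (n : ℝ) / 2 →
        CusumTest.MeanShiftModel P X ξ μ δ m →
        CusumTest.GaussianMultipliers P e X →
        CusumTest.Alternative n δ m →
        u ≤ (m : ℝ) → (m : ℝ) ≤ (n : ℝ) - u →
        CusumTest.CondA P ξ bl → CusumTest.CondB P ξ bu → CusumTest.CondD P ξ bu q →
        ζ ∈ Set.Ioo (0 : ℝ) (1 / 2) → γ ∈ Set.Ioo (0 : ℝ) (Real.exp (-1)) →
        Real.log γ⁻¹ ≤ K * Real.log ((p : ℝ) * n) →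
        α ∈ Set.Ioo (0 : ℝ) 1 →
        ‖δ‖ ≤ 1 →
        C₁ * CusumTest.signalThreshold n p m ζ α ≤ ‖δ‖ →
        1 - γ - C₂ * (CusumTest.rateOne n p u + CusumTest.rateTwo n p u γ q) - 2 * ζ ≤
          P.real (CusumTest.rejectionEvent P u α X e)) := by
  have hC₁ : 0 < (1 + bu) + 3 + 2 * √(4 * (1 + bu) + 4) := by positivity
  -- `C₁` is the signal constant at `V = 1 + bu`. In `C₂`, the `3` covers the errors `1/(np)`, three
  -- in (i) and two in (ii); the multiples of `bu` give `11² ≥ 108` and `2² ≥ 3` in the checks of `3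
  -- L² b ≤ u`.
  refine ⟨⟨(1 + bu) + 3 + 2 * √(4 * (1 + bu) + 4), hC₁, 3 + 11 * bu, by positivity, ?_⟩,
    fun q hq => ⟨(1 + bu) + 3 + 2 * √(4 * (1 + bu) + 4), hC₁, 3 + 2 * bu, by positivity, ?_⟩⟩
  · intro Ω _ P _ n p m u ζ γ α μ δ X ξ e hn hp hu hun hX he hH hum hmu hA hB hC hζ hγ hγK hα hδ hsig
    have hn' : (4 : ℝ) ≤ n := by exact_mod_cast hn
    have hp' : (3 : ℝ) ≤ p := by exact_mod_cast hp
    have hnp : (12 : ℝ) ≤ (n : ℝ) * p := by nlinarith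
    have hu0 : 0 < u := by linarith
    have hb := CusumTest.one_le_log_mul hn hp
    have hr := CusumTest.one_div_le_rateOne hn hp hu0 (by linarith : u ≤ n)
    -- If the rate term exceeds `1`, the asserted lower bound is negative.
    rcases lt_or_ge 1 ((3 + 11 * bu) * CusumTest.rateOne n p u) with hbig | hsmall
    · have : 0 ≤ P.real (CusumTest.rejectionEvent P u α X e) := measureReal_nonneg
      linarith [hζ.1, hγ.1]
    have hrate := CusumTest.le_of_mul_rateOne_le_one hn hp hu0 (by linarith) hsmall
    have hLu : 3 * (6 * bu * Real.log ((n : ℝ) * p)) ^ 2 * Real.log ((n : ℝ) * p) ≤ u := by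
      refine le_trans ?_ hrate
      have h37 : Real.log ((n : ℝ) * p) ^ 3 ≤ Real.log ((n : ℝ) * p) ^ 7 :=
        pow_le_pow_right₀ hb (by norm_num)
      calc 3 * (6 * bu * Real.log ((n : ℝ) * p)) ^ 2 * Real.log ((n : ℝ) * p)
          = 108 * bu ^ 2 * Real.log ((n : ℝ) * p) ^ 3 := by ring
        _ ≤ (3 + 11 * bu) ^ 2 * Real.log ((n : ℝ) * p) ^ 7 := by
            gcongr
            nlinarith
    have hρ : P.real {ω | ∃ i j, 6 * bu * Real.log ((n : ℝ) * p) < |ξ i ω j|} ≤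
        1 / (n * p) := by
      refine (hC.measureReal_exists_lt_abs_le hX.measurable_noise hbu hb).trans ?_
      have h3 : Real.exp (-(3 * Real.log ((n : ℝ) * p))) = 1 / ((n : ℝ) * p) ^ 3 := by
        rw [Real.exp_neg, mul_comm, Real.exp_mul, Real.exp_log (by linarith), one_div]
        norm_cast
      rw [h3]
      have : (n : ℝ) * p * (2 * (1 / ((n : ℝ) * p) ^ 3)) = 2 / (n * p) * (1 / (n * p)) := by
        field_simp
      rw [this]
      exact mul_le_of_le_one_left (by positivity) ((div_le_one (by linarith)).2 (by linarith))
    have hmain := CusumTest.le_measureReal_rejectionEvent hn hp hu hX he hum hmu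
      (fun i j => (hB.integrable_sq_and_integral_le hX.measurable_noise i j).1)
      (fun i j => (hB.integrable_sq_and_integral_le hX.measurable_noise i j).2)
      (by linarith) (by positivity) hLu hρ hζ.1 (by linarith [hζ.2]) hα.1 hα.2 hδ hsig
    have e3 : 2 / ((n : ℝ) * p) = 2 * (1 / (n * p)) := by ring
    have hr0 : 0 ≤ CusumTest.rateOne n p u := le_trans (by positivity) hr
    have := mul_nonneg hbu.le hr0
    linarith [hζ.1, hγ.1]
  · intro Ω _ P _ n p m u ζ γ α μ δ X ξ e hn hp hu hun hX he hH hum hmu hA hB hD hζ hγ hγK hα hδ hsig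
    have hn' : (4 : ℝ) ≤ n := by exact_mod_cast hn
    have hp' : (3 : ℝ) ≤ p := by exact_mod_cast hp
    have hu0 : 0 < u := by linarith
    have hγ0 := hγ.1
    have hb := CusumTest.one_le_log_mul hn hp
    have hr := CusumTest.one_div_le_rateOne hn hp hu0 (by linarith : u ≤ n)
    have hr0 : 0 ≤ CusumTest.rateOne n p u := le_trans (by positivity) hr
    have hr2 : 0 ≤ CusumTest.rateTwo n p u γ q := by
      unfold CusumTest.rateTwo
      positivity
    rcases lt_or_ge 1 ((3 + 2 * bu) *
      (CusumTest.rateOne n p u + CusumTest.rateTwo n p u γ q)) with hbig | hsmall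
    · have : 0 ≤ P.real (CusumTest.rejectionEvent P u α X e) := measureReal_nonneg
      linarith [hζ.1, hγ.1]
    -- Only `ϖ_{2,n}` controls the envelope here; `ϖ_{1,n} ≥ 0` is discarded from the sum.
    have hrate := CusumTest.le_of_mul_rateTwo_le_one (q := q) (C := 3 + 2 * bu) hn hp hu0 hγ.1
      (by linarith) (by nlinarith)
    have hLu : 3 * (bu * ((n : ℝ) / γ) ^ (1 / q)) ^ 2 * Real.log ((n : ℝ) * p) ≤ u := by
      refine le_trans ?_ hrate
      have h13 : Real.log ((n : ℝ) * p) ≤ Real.log ((n : ℝ) * p) ^ 3 :=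
        le_self_pow₀ hb (by norm_num)
      have hpow : (((n : ℝ) / γ) ^ (1 / q)) ^ 2 = ((n : ℝ) / γ) ^ (2 / q) := by
        rw [← Real.rpow_natCast, ← Real.rpow_mul (by positivity)]
        congr 1
        push_cast
        ring
      calc 3 * (bu * ((n : ℝ) / γ) ^ (1 / q)) ^ 2 * Real.log ((n : ℝ) * p)
          = 3 * bu ^ 2 * (((n : ℝ) / γ) ^ (2 / q) * Real.log ((n : ℝ) * p)) := by
            rw [mul_pow, hpow]
            ring
        _ ≤ (3 + 2 * bu) ^ 2 * (((n : ℝ) / γ) ^ (2 / q) * Real.log ((n : ℝ) * p) ^ 3) := by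
            gcongr
            nlinarith
    have hmain := CusumTest.le_measureReal_rejectionEvent hn hp hu hX he hum hmu
      (fun i j => (hB.integrable_sq_and_integral_le hX.measurable_noise i j).1)
      (fun i j => (hB.integrable_sq_and_integral_le hX.measurable_noise i j).2)
      (by linarith) (by positivity) hLu
      (hD.measureReal_exists_lt_abs_le hX.measurable_noise hbu hq hγ.1 (by omega)) hζ.1
      (by linarith [hζ.2]) hα.1 hα.2 hδ hsig
    have e3 : 2 / ((n : ℝ) * p) = 2 * (1 / (n * p)) := by ring
    have f1 := mul_nonneg hbu.le hr0
    have f2 := mul_nonneg hbu.le hr2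
    linarith [hζ.1]
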